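/- Conventions. Let $\mathbb F$ be a field. A symplectic alternating algebra (SAA) over $\mathbb F$ is an $\mathbb F$-vector space $L$ with a non-degenerate alternating form $(\cdot,\cdot)$ and a bilinear alternating product such that $(xy,z)=(yz,x)$ for all $x,y,z\in L$; isomorphisms of SAAs are the linear bijections that preserve the product and the form. Put $L^1=L$, $L^{k+1}=L^kL$, $Z_0(L)=0$, $Z_{k+1}(L)=\{x\in L: xL\le Z_k(L)\}$ and $Z(L)=Z_1(L)$; $L$ is nilpotent if $L^k=0$ for some $k$. A standard basis of an SAA of dimension $10$ is a basis $x_1,y_1,\dots,x_5,y_5$ with $(x_i,x_j)=(y_i,y_j)=0$ and $(x_i,y_j)=\delta_{ij}$. A nilpotent presentation lists values of $(x_iy_j,y_k)$ and $(y_iy_j,y_k)$ with $i<j<k$; all triple values of basis elements that are not listed (up to reordering) are $0$. It determines an SAA up to isomorphism, the algebra that it describes. For $r,s\in\mathbb F$ let $$\mathcal P_{10}^{(3,8)}(r,s):\ (x_2y_4,y_5)=r,\ (x_1y_3,y_5)=s,\ (x_1y_2,y_4)=1,\ (y_1y_2,y_5)=1,\ (y_1y_3,y_4)=1.$$ Proposition.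 Let $\mathbb F$ be a field of characteristic different from $2$. (1) Let $L$ be a nilpotent SAA over $\mathbb F$ of dimension $10$ whose centre $Z(L)$ is isotropic of dimension $3$, with $\dim L^3=6$ and $L^3L^2=L^5$. Choose $y_2\in L^2\setminus L^3$ and $y_3\in Z_4(L)\setminus L^2$, let $\phi,\psi:L^3/L^4\to L^5$ be the linear maps $u+L^4\mapsto uy_2$ and $u+L^4\mapsto uy_3$ ($\phi$ is bijective), and let $\tau=\psi\phi^{-1}:L^5\to L^5$. Suppose that $L$ is of type C, that is, the minimal polynomial of $\tau$ is irreducible in $\mathbb F[t]$ (this does not depend on the choice of $y_2$ and $y_3$). Then, with respect to some standard basis, $L$ has the presentation $\mathcal P_{10}^{(3,8)}(r,s)$ for some $r,s\in\mathbb F$ with $r\neq0$ and $s\notin\mathbb F^2=\{a^2:a\in\mathbb F\}$. (2) Let $r,\tilde r\in\mathbb F\setminus\{0\}$ and $s,\tilde s\in\mathbb F\setminus\mathbb F^2$. The presentations $\mathcal P_{10}^{(3,8)}(\tilde r,\tilde s)$ and $\mathcal P_{10}^{(3,8)}(r,s)$ describe the same algebra up to isomorphism if and only if $\tilde r/r\in(\mathbb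 F^*)^3$ and $s/\tilde s\in G(s)$, where $G(s)=\{(x^2-y^2s)^2:(x,y)\in\mathbb F\times\mathbb F\setminus\{(0,0)\}\}$. -/

import Mathlib

/-- A symplectic alternating algebra structure on a vector space `L`: a non-degenerate alternating
form and an alternating product with `(x·y, z) = (y·z, x)`. -/
structure SympAltAlg (F : Type*) [Field F] (L : Type*) [AddCommGroup L] [Module F L] where
  form : L →ₗ[F] L →ₗ[F] F
  mul : L →ₗ[F] L →ₗ[F] L
  form_self : ∀ x, form x x = 0
  form_nondegenerate : ∀ x, (∀ y, form x y = 0) → x = 0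
  mul_self : ∀ x, mul x x = 0
  form_mul : ∀ x y z, form (mul x y) z = form (mul y z) x

namespace SympAltAlg

section General

variable {F : Type*} [Field F] {L : Type*} [AddCommGroup L] [Module F L]
  {M : Type*} [AddCommGroup M] [Module F M]

/-- An isomorphism of symplectic alternating algebras: a linear bijection that preserves both the
product and the form. -/
structure Iso (A : SympAltAlg F L) (B : SympAltAlg F M) extends L ≃ₗ[F] M where
  map_mul : ∀ x y, toLinearEquiv (A.mul x y) = B.mul (toLinearEquiv x) (toLinearEquiv y)
  map_form : ∀ x y, B.form (toLinearEquiv x) (toLinearEquiv y) = A.form x y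

/-- The product `U·V` of two subspaces: the span of all `u·v`. -/
def prod (A : SympAltAlg F L) (U V : Submodule F L) : Submodule F L :=
  Submodule.map₂ A.mul U V

/-- The lower central series with the usual indexing `L^1 = L`, `L^(k+1) = L^k·L`
(and, as a convention, `L^0 = L`). -/
def pow (A : SympAltAlg F L) : ℕ → Submodule F L
  | 0 => ⊤
  | 1 => ⊤
  | k + 2 => A.prod (A.pow (k + 1)) ⊤

/-- The upper central series: `Z_0 = 0`, `Z_(k+1) = {x | x·L ≤ Z_k}`. -/
def upper (A : SympAltAlg F L) : ℕ → Submodule F L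
  | 0 => ⊥
  | k + 1 =>
    { carrier := {x | ∀ y, A.mul x y ∈ A.upper k}
      add_mem' := fun hx hy z => by
        simpa using (A.upper k).add_mem (hx z) (hy z)
      zero_mem' := fun z => by simp
      smul_mem' := fun c x hx z => by
        simpa using (A.upper k).smul_mem c (hx z) }

/-- The centre `Z(L) = {x | x·L = 0}`. -/
def center (A : SympAltAlg F L) : Submodule F L := A.upper 1

def IsNilpotent (A : SympAltAlg F L) : Prop := ∃ k, A.pow k = ⊥

/-- A subspace is isotropic if the form vanishes on it. -/
def IsIsotropic (A : SympAltAlg F L) (U : Submodule F L) : Prop :=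
  ∀ u ∈ U, ∀ v ∈ U, A.form u v = 0

/-- A standard basis `x_1, y_1, …, x_n, y_n`, where `x_(i+1) = b (inl i)`, `y_(i+1) = b (inr i)`. -/
structure IsStandardBasis {n : ℕ} (A : SympAltAlg F L)
    (b : Module.Basis (Fin n ⊕ Fin n) F L) : Prop where
  form_xx : ∀ i j, A.form (b (Sum.inl i)) (b (Sum.inl j)) = 0
  form_yy : ∀ i j, A.form (b (Sum.inr i)) (b (Sum.inr j)) = 0
  form_xy : ∀ i j, A.form (b (Sum.inl i)) (b (Sum.inr j)) = if i = j then 1 else 0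

end General

/-- The data `(x_i y_j, y_k) = xyy i j k` and `(y_i y_j, y_k) = yyy i j k` of a nilpotent
presentation. Only the values with `i < j < k` matter. -/
structure NilpPres (F : Type*) (n : ℕ) where
  xyy : Fin n → Fin n → Fin n → F
  yyy : Fin n → Fin n → Fin n → F

/-- `A` has the nilpotent presentation `P` with respect to the standard basis `b`: the listed
triples have the listed values, and all triples of basis elements that are not listed (up to
reordering) have the value `0`. -/
structure IsPresentedBy {F : Type*} [Field F] {L : Type*} [AddCommGroup L] [Module F L] {n : ℕ}
    (A : SympAltAlg F L) (b : Module.Basis (Fin n ⊕ Fin n) F L) (P : NilpPres F n) : Prop where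
  standard : A.IsStandardBasis b
  xyy : ∀ i j k, i < j → j < k →
    A.form (A.mul (b (Sum.inl i)) (b (Sum.inr j))) (b (Sum.inr k)) = P.xyy i j k
  yyy : ∀ i j k, i < j → j < k →
    A.form (A.mul (b (Sum.inr i)) (b (Sum.inr j))) (b (Sum.inr k)) = P.yyy i j k
  xyy_zero : ∀ i j k, j ≤ i → j < k →
    A.form (A.mul (b (Sum.inl i)) (b (Sum.inr j))) (b (Sum.inr k)) = 0
  xxy_zero : ∀ i j k, A.form (A.mul (b (Sum.inl i)) (b (Sum.inl j))) (b (Sum.inr k)) = 0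
  xxx_zero : ∀ i j k, A.form (A.mul (b (Sum.inl i)) (b (Sum.inl j))) (b (Sum.inl k)) = 0

/-- `A` has the presentation `P` with respect to some standard basis. -/
def HasPresentation {F : Type*} [Field F] {L : Type*} [AddCommGroup L] [Module F L] {n : ℕ}
    (A : SympAltAlg F L) (P : NilpPres F n) : Prop :=
  ∃ b : Module.Basis (Fin n ⊕ Fin n) F L, A.IsPresentedBy b P

namespace NilpPres

variable {F : Type*} [Field F] {n : ℕ}

/-- The alternating trilinear form on `F^ι` which is `1` on the unit vectors `e_p, e_q, e_t`
(`p, q, t` distinct) and `0` on triples of unit vectors that are not a reordering of these. -/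
def minor {ι : Type*} (p q t : ι) (u v w : ι → F) : F :=
  Matrix.det !![u p, u q, u t; v p, v q, v t; w p, w q, w t]

/-- The trilinear form `(u·v, w)` of the algebra with presentation `P`, in coordinates. -/
def triple (P : NilpPres F n) (u v w : Fin n ⊕ Fin n → F) : F :=
  ∑ i, ∑ j, ∑ k, if i < j ∧ j < k then
    P.xyy i j k * minor (Sum.inl i) (Sum.inr j) (Sum.inr k) u v w
      + P.yyy i j k * minor (Sum.inr i) (Sum.inr j) (Sum.inr k) u v w
  else 0

theorem triple_add_left (P : NilpPres F n) (u u' v w : Fin n ⊕ Fin n → F) :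
    P.triple (u + u') v w = P.triple u v w + P.triple u' v w := by
  simp only [triple, ← Finset.sum_add_distrib]
  refine Finset.sum_congr rfl fun i _ => Finset.sum_congr rfl fun j _ =>
    Finset.sum_congr rfl fun k _ => ?_
  split_ifs
  · simp [minor, Matrix.det_fin_three]; ring
  · simp

theorem triple_smul_left (P : NilpPres F n) (c : F) (u v w : Fin n ⊕ Fin n → F) :
    P.triple (c • u) v w = c * P.triple u v w := by
  simp only [triple, Finset.mul_sum]
  refine Finset.sum_congr rfl fun i _ => Finset.sum_congr rfl fun j _ =>
    Finset.sum_congr rfl fun k _ => ?_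
  split_ifs
  · simp [minor, Matrix.det_fin_three]; ring
  · simp

theorem triple_self (P : NilpPres F n) (u w : Fin n ⊕ Fin n → F) : P.triple u u w = 0 := by
  simp only [triple]
  refine Finset.sum_eq_zero fun i _ => Finset.sum_eq_zero fun j _ =>
    Finset.sum_eq_zero fun k _ => ?_
  split_ifs
  · simp [minor, Matrix.det_fin_three]; ring
  · simp

theorem triple_rotate (P : NilpPres F n) (u v w : Fin n ⊕ Fin n → F) :
    P.triple u v w = P.triple v w u := by
  simp only [triple]
  refine Finset.sum_congr rfl fun i _ => Finset.sum_congr rfl fun j _ =>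
    Finset.sum_congr rfl fun k _ => ?_
  split_ifs
  · simp [minor, Matrix.det_fin_three]; ring
  · simp

/-- The standard symplectic form in the coordinates of a standard basis. -/
def stdForm (F : Type*) [Field F] (n : ℕ) :
    (Fin n ⊕ Fin n → F) →ₗ[F] (Fin n ⊕ Fin n → F) →ₗ[F] F :=
  LinearMap.mk₂ F
    (fun u v => ∑ i, (u (Sum.inl i) * v (Sum.inr i) - u (Sum.inr i) * v (Sum.inl i)))
    (fun u u' v => by
      rw [← Finset.sum_add_distrib]; refine Finset.sum_congr rfl fun i _ => ?_; simp; ring)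
    (fun c u v => by
      rw [smul_eq_mul, Finset.mul_sum]; refine Finset.sum_congr rfl fun i _ => ?_; simp; ring)
    (fun u v v' => by
      rw [← Finset.sum_add_distrib]; refine Finset.sum_congr rfl fun i _ => ?_; simp; ring)
    (fun c u v => by
      rw [smul_eq_mul, Finset.mul_sum]; refine Finset.sum_congr rfl fun i _ => ?_; simp; ring)

/-- The product determined by `(u·v, w) = P.triple u v w`: the `x_i`-coordinate of `u·v` is
`(u·v, y_i)` and its `y_i`-coordinate is `-(u·v, x_i)`. -/
def stdMul (P : NilpPres F n) :
    (Fin n ⊕ Fin n → F) →ₗ[F] (Fin n ⊕ Fin n → F) →ₗ[F] (Fin n ⊕ Fin n → F) :=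
  LinearMap.mk₂ F
    (fun u v => Sum.elim (fun i => P.triple u v (Pi.single (Sum.inr i) 1))
      (fun i => - P.triple u v (Pi.single (Sum.inl i) 1)))
    (fun u u' v => by
      ext (i | i) <;> simp [triple_add_left]; ring)
    (fun c u v => by
      ext (i | i) <;> simp [triple_smul_left])
    (fun u v v' => by
      ext (i | i) <;> simp only [Pi.add_apply, Sum.elim_inl, Sum.elim_inr] <;>
        rw [P.triple_rotate u, P.triple_rotate u, P.triple_rotate u, triple_add_left]
      ring)
    (fun c u v => by
      ext (i | i) <;> simp only [Pi.smul_apply, Sum.elim_inl, Sum.elim_inr, smul_eq_mul] <;>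
        rw [P.triple_rotate u, P.triple_rotate u, triple_smul_left]
      ring)

theorem stdForm_stdMul (P : NilpPres F n) (u v w : Fin n ⊕ Fin n → F) :
    stdForm F n (P.stdMul u v) w = P.triple u v w := by
  let T : (Fin n ⊕ Fin n → F) →ₗ[F] F :=
    { toFun := fun w => P.triple u v w
      map_add' := fun w w' => by
        rw [← triple_rotate P (w + w'), ← triple_rotate P w, ← triple_rotate P w', triple_add_left]
      map_smul' := fun c w => by
        rw [← triple_rotate P (c • w), ← triple_rotate P w, triple_smul_left]; rfl }
  change _ = T w
  rw [LinearMap.pi_apply_eq_sum_univ T w, Fintype.sum_sum_type, ← Finset.sum_add_distrib]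
  simp only [stdForm, stdMul, LinearMap.mk₂_apply, Sum.elim_inl, Sum.elim_inr]
  refine Finset.sum_congr rfl fun i _ => ?_
  have h : ∀ a : Fin n ⊕ Fin n, (fun j => if a = j then (1 : F) else 0) = Pi.single a 1 := by
    intro a; ext j; simp [Pi.single_apply, eq_comm]
  simp only [h, smul_eq_mul]
  change _ = w (Sum.inl i) * P.triple u v (Pi.single (Sum.inl i) 1)
    + w (Sum.inr i) * P.triple u v (Pi.single (Sum.inr i) 1)
  ring

/-- The symplectic alternating algebra (of dimension `2n`) that the presentation `P` describes:
the unit vectors of `F^(2n)` are the standard basis. -/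
def algebra (P : NilpPres F n) : SympAltAlg F (Fin n ⊕ Fin n → F) where
  form := stdForm F n
  mul := P.stdMul
  form_self u := by
    simp only [stdForm, LinearMap.mk₂_apply]
    exact Finset.sum_eq_zero fun i _ => by ring
  form_nondegenerate u h := by
    ext (i | i)
    · simpa [stdForm, Pi.single_apply] using h (Pi.single (Sum.inr i) 1)
    · simpa [stdForm, Pi.single_apply] using h (Pi.single (Sum.inl i) 1)
  mul_self u := by
    ext (i | i) <;> simp [stdMul, triple_self]
  form_mul u v w := by
    rw [stdForm_stdMul, stdForm_stdMul, triple_rotate]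

/-- Two presentations describe the same algebra: the algebras they determine are isomorphic. -/
def DescribeSame (P Q : NilpPres F n) : Prop := Nonempty (Iso P.algebra Q.algebra)

/-- `P_10^(3,8)(r,s)`: `(x₂y₄,y₅) = r`, `(x₁y₃,y₅) = s`, `(x₁y₂,y₄) = 1`, `(y₁y₂,y₅) = 1`,
`(y₁y₃,y₄) = 1`. The indices of the code start at `0`. -/
def P38 (r s : F) : NilpPres F 5 where
  xyy i j k :=
    if i = 1 ∧ j = 3 ∧ k = 4 then r
    else if i = 0 ∧ j = 2 ∧ k = 4 then s
    else if i = 0 ∧ j = 1 ∧ k = 3 then 1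
    else 0
  yyy i j k :=
    if i = 0 ∧ j = 1 ∧ k = 4 then 1
    else if i = 0 ∧ j = 2 ∧ k = 3 then 1
    else 0

end NilpPres

section TypeC

variable {F : Type*} [Field F] {L : Type*} [AddCommGroup L] [Module F L]

/-- `τ : L^5 → L^5` is the map `ψ φ⁻¹` belonging to the elements `y₂`, `y₃`, where
`φ, ψ : L^3 / L^4 → L^5` are the linear maps induced by `u ↦ u·y₂` (bijective) and `u ↦ u·y₃`. -/
def IsTau (A : SympAltAlg F L) (y₂ y₃ : L) (τ : Module.End F (A.pow 5)) : Prop :=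
  ∃ (φ : (A.pow 3 ⧸ (A.pow 4).submoduleOf (A.pow 3)) ≃ₗ[F] A.pow 5)
    (ψ : (A.pow 3 ⧸ (A.pow 4).submoduleOf (A.pow 3)) →ₗ[F] A.pow 5),
    (∀ u : A.pow 3, (φ (Submodule.Quotient.mk u) : L) = A.mul u y₂) ∧
    (∀ u : A.pow 3, (ψ (Submodule.Quotient.mk u) : L) = A.mul u y₃) ∧
    τ = ψ ∘ₗ φ.symm.toLinearMap

/-- Type C: the minimal polynomial of `τ = ψ φ⁻¹` is irreducible over `F`. In a standard basis
adapted to the central series, `L^2 = L^3 + F y₂` and `Z_4(L) = L^2 + F y₃`; these two elements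
enter only through `y₂ ∈ L^2 \ L^3` and `y₃ ∈ Z_4(L) \ L^2`. Neither the existence of `τ` (it is
unique once `y₂`, `y₃` are given) nor the independence of the choice of `y₂`, `y₃` is built in. -/
def IsTypeC (A : SympAltAlg F L) : Prop :=
  ∃ y₂ ∈ A.pow 2, y₂ ∉ A.pow 3 ∧ ∃ y₃ ∈ A.upper 4, y₃ ∉ A.pow 2 ∧
    ∀ τ : Module.End F (A.pow 5), A.IsTau y₂ y₃ τ → Irreducible (minpoly F τ)

end TypeC

/-- `G(s) = {(x² - y² s)² : (x, y) ≠ (0, 0)}`. -/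
def G {F : Type*} [Field F] (s : F) : Set F :=
  {g | ∃ x y : F, (x, y) ≠ (0, 0) ∧ g = (x ^ 2 - y ^ 2 * s) ^ 2}

end SympAltAlg

/-! The triple form $(xy,z)$ is alternating in all three arguments, so the two central series are
dual: $Z_k=(L^{k+1})^\perp$ (`upper_eq_perp`), and every inclusion between their terms has a dual
one. In the class of part (1) this duality, nilpotency and dimension counts give $L^3L^3=0$,
$L^4=Z_2(L)$ of dimension $4$, and $L^5\le Z(L)$ of dimension $2$. Multiplication by $y_2$ and by
$y_3$ thus map the plane $L^3/L^4$ to the plane $L^5$, the first bijectively.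

The endomorphism $\tau$ is not a scalar $c$: otherwise $y_3-cy_2$ would annihilate $L^3$ and so lie
in $L^2$ (`mem_pow_two_of_mul_pow_three`). For type C its minimal polynomial is therefore an
irreducible quadratic, and completing the square, that is replacing $y_3$ by $y_3-ty_2$, gives
$\tau^2=s$ with $s$ not a square. Any $y_1\in L^3$ with $y_1y_2\ne0$, and $x_1$ with
$x_1y_2=y_1y_3$, then satisfy $x_1y_3=s\,y_1y_2$ (`exists_rational_form`). The only other invariant
constant is $r=(x_2y_4,y_5)$, nonzero because $x_2$ is not central. All other constants are removed
by shifts inside $L^2$ (`exists_reduced`), and central corrections make the basis standard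
(`exists_standard_of_mod_center`).

For part (2), an element $d+e\sqrt s$ of $\mathbb F(\sqrt s)$ acting on the plane of $x_1,y_1$,
together with a scaling of $x_2$ by $c$, extends to an isomorphism under which $r$ changes by $c^3$
and $s$ by the squared inverse of the norm $d^2-e^2s$ (`describeSame_P38`). Conversely, an
isomorphism preserves $L^2$ and annihilators, which forces enough zero coordinates for the remaining
equations to be solved explicitly (`parameters_eq`). -/

namespace SympAltAlg

/-! ### The alternating triple form and the duality of the central series -/

section Basics

variable {F : Type*} [Field F] {L : Type*} [AddCommGroup L] [Module F L] (A : SympAltAlg F L)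

theorem form_skew (x y : L) : A.form x y = -A.form y x := by
  have h := A.form_self (x + y)
  simp only [map_add, LinearMap.add_apply, A.form_self] at h
  linear_combination h

theorem mul_skew (x y : L) : A.mul x y = -A.mul y x := by
  have h := A.mul_self (x + y)
  simp only [map_add, LinearMap.add_apply, A.mul_self] at h
  rw [eq_neg_iff_add_eq_zero]
  simpa [add_comm] using h

theorem form_mul_swap (x y z : L) : A.form (A.mul x y) z = -A.form (A.mul y x) z := by
  rw [A.mul_skew x y, map_neg, LinearMap.neg_apply]

theorem form_mul_swap_right (x y z : L) : A.form (A.mul x y) z = -A.form (A.mul x z) y := by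
  rw [A.form_mul, A.form_mul_swap, ← A.form_mul x z y]

theorem form_mul_self_left (x z : L) : A.form (A.mul x x) z = 0 := by
  rw [A.mul_self, map_zero, LinearMap.zero_apply]

theorem form_mul_self_right (x y : L) : A.form (A.mul x y) y = 0 := by
  rw [A.form_mul, A.form_mul_self_left]

theorem form_mul_self_outer (x y : L) : A.form (A.mul x y) x = 0 := by
  rw [A.form_mul, A.form_mul_self_right]

theorem isRefl : LinearMap.IsRefl A.form := fun x y h => by
  rw [A.form_skew, h, neg_zero]

theorem nondegenerate : LinearMap.BilinForm.Nondegenerate A.form := by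
  refine ⟨A.form_nondegenerate, fun y h => A.form_nondegenerate y fun x => ?_⟩
  rw [A.form_skew, h, neg_zero]

/-- The orthogonal complement of a subspace with respect to the symplectic form. -/
def perp (U : Submodule F L) : Submodule F L := LinearMap.BilinForm.orthogonal A.form U

variable {A} in
theorem mem_perp {U : Submodule F L} {x : L} : x ∈ A.perp U ↔ ∀ u ∈ U, A.form u x = 0 := Iff.rfl

variable {A} in
theorem mem_perp' {U : Submodule F L} {x : L} : x ∈ A.perp U ↔ ∀ u ∈ U, A.form x u = 0 := by
  simp only [mem_perp, A.form_skew x, neg_eq_zero]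

theorem perp_anti {U V : Submodule F L} (h : U ≤ V) : A.perp V ≤ A.perp U :=
  LinearMap.BilinForm.orthogonal_le h

theorem finrank_perp [FiniteDimensional F L] (U : Submodule F L) :
    Module.finrank F (A.perp U) + Module.finrank F U = Module.finrank F L := by
  rw [perp, LinearMap.BilinForm.finrank_orthogonal A.nondegenerate,
    Nat.sub_add_cancel (Submodule.finrank_le U)]

theorem perp_perp [FiniteDimensional F L] (U : Submodule F L) : A.perp (A.perp U) = U :=
  LinearMap.BilinForm.orthogonal_orthogonal A.nondegenerate A.isRefl U

theorem mul_mem_prod {U V : Submodule F L} {u v : L} (hu : u ∈ U) (hv : v ∈ V) :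
    A.mul u v ∈ A.prod U V := Submodule.apply_mem_map₂ _ hu hv

theorem prod_le {U V W : Submodule F L} (h : ∀ u ∈ U, ∀ v ∈ V, A.mul u v ∈ W) :
    A.prod U V ≤ W := Submodule.map₂_le.2 h

theorem mul_mem_pow_succ {k : ℕ} {u : L} (hu : u ∈ A.pow (k + 1)) (v : L) :
    A.mul u v ∈ A.pow (k + 2) := A.mul_mem_prod hu Submodule.mem_top

theorem pow_succ_le (k : ℕ) : A.pow (k + 1) ≤ A.pow k := by
  induction k with
  | zero => exact le_rfl
  | succ k ih =>
    cases k with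
    | zero => exact le_top
    | succ k => exact A.prod_le fun u hu v _ => A.mul_mem_pow_succ (ih hu) v

theorem pow_anti : Antitone A.pow := antitone_nat_of_succ_le A.pow_succ_le

/-- In a nilpotent algebra the lower central series is strictly decreasing until it vanishes. -/
theorem pow_eq_bot_of_le (hn : A.IsNilpotent) {k : ℕ} (h : A.pow (k + 1) ≤ A.pow (k + 2)) :
    A.pow (k + 1) = ⊥ := by
  have key : ∀ m, A.pow (k + 1) ≤ A.pow (k + 1 + m) := by
    intro m
    induction m with
    | zero => exact le_rfl
    | succ m ih =>
      refine h.trans (A.prod_le fun u hu v _ => ?_)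
      have := A.mul_mem_pow_succ (k := k + m) (by convert ih hu using 2; omega) v
      convert this using 2; omega
  obtain ⟨c, hc⟩ := hn
  exact le_bot_iff.1 ((key c).trans (hc ▸ A.pow_anti (by omega)))

theorem mem_upper_succ {k : ℕ} {x : L} : x ∈ A.upper (k + 1) ↔ ∀ y, A.mul x y ∈ A.upper k :=
  Iff.rfl

theorem mem_upper_one {x : L} : x ∈ A.upper 1 ↔ ∀ y, A.mul x y = 0 := by
  rw [mem_upper_succ]; simp [upper]

/-- Induction on `k` through $(xy,u)=-(uy,x)$: $xL$ is orthogonal to $L^{k+1}$ exactly when $x$ is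
orthogonal to $L^{k+1}L$. -/
theorem upper_eq_perp (k : ℕ) : A.upper k = A.perp (A.pow (k + 1)) := by
  induction k with
  | zero =>
    refine (eq_bot_iff.2 fun x hx => ?_).symm
    exact A.form_nondegenerate x fun y => mem_perp'.1 hx y Submodule.mem_top
  | succ k ih =>
    ext x
    have key : ∀ y u, A.form (A.mul x y) u = -A.form (A.mul u y) x := fun y u => by
      rw [A.form_mul, A.form_mul_swap]
    rw [mem_upper_succ, ih]
    constructor
    · intro h
      have : A.pow (k + 2) ≤ A.perp (Submodule.span F {x}) := by
        refine A.prod_le fun u hu v _ => mem_perp'.2 fun w hw => ?_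
        obtain ⟨c, rfl⟩ := Submodule.mem_span_singleton.1 hw
        rw [map_smul, ← neg_eq_zero, ← smul_neg, ← key, mem_perp'.1 (h v) u hu, smul_zero]
      exact mem_perp.2 fun u hu => mem_perp'.1 (this hu) x (Submodule.mem_span_singleton_self x)
    · intro h y
      refine mem_perp'.2 fun u hu => ?_
      rw [key, mem_perp.1 h _ (A.mul_mem_pow_succ hu y), neg_zero]

theorem upper_mono : Monotone A.upper := monotone_nat_of_le_succ fun k => by
  rw [upper_eq_perp, upper_eq_perp]
  exact A.perp_anti (A.pow_succ_le _)

theorem perp_upper [FiniteDimensional F L] (k : ℕ) : A.perp (A.upper k) = A.pow (k + 1) := by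
  rw [upper_eq_perp, perp_perp]

theorem finrank_upper [FiniteDimensional F L] (k : ℕ) :
    Module.finrank F (A.upper k) + Module.finrank F (A.pow (k + 1)) = Module.finrank F L := by
  rw [upper_eq_perp, finrank_perp]

theorem form_upper_pow {k : ℕ} {z u : L} (hz : z ∈ A.upper k) (hu : u ∈ A.pow (k + 1)) :
    A.form z u = 0 := by
  rw [upper_eq_perp] at hz
  exact mem_perp'.1 hz u hu

/-- By $(zu,w)=-(zw,u)$, where $zw\in Z_{k-1}$ is orthogonal to $L^k$. -/
theorem mul_upper_pow {k : ℕ} {z u : L} (hz : z ∈ A.upper k) (hu : u ∈ A.pow k) :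
    A.mul z u = 0 := by
  refine A.form_nondegenerate _ fun w => ?_
  rw [A.form_mul_swap_right]
  cases k with
  | zero =>
    rw [show z = 0 by simpa [upper] using hz]; simp
  | succ k => rw [A.form_upper_pow (hz w) hu, neg_zero]

end Basics
end SympAltAlg

namespace SympAltAlg

/-! ### Products and dimensions of the central series -/

section Structure

open Module Submodule

variable {F : Type*} [Field F] {L : Type*} [AddCommGroup L] [Module F L]

/-- Nilpotent algebras of dimension `10` with isotropic centre of dimension `3`,
`dim L^3 = 6` and `L^3·L^2 = L^5`. -/
structure IsClass38 (A : SympAltAlg F L) : Prop where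
  finrank_eq : finrank F L = 10
  nilpotent : A.IsNilpotent
  isotropic : A.IsIsotropic (A.upper 1)
  finrank_upper_one : finrank F (A.upper 1) = 3
  finrank_pow_three : finrank F (A.pow 3) = 6
  prod_eq : A.prod (A.pow 3) (A.pow 2) = A.pow 5

/-- A subspace that is proper in `V` but of codimension at most one, enlarged by a vector. -/
theorem sup_span_singleton_eq {U V : Submodule F L} [FiniteDimensional F L] {v : L} (hUV : U ≤ V)
    (hv : v ∈ V) (hv' : v ∉ U) (h : finrank F V ≤ finrank F U + 1) : U ⊔ F ∙ v = V := by
  refine eq_of_le_of_finrank_le (sup_le hUV ((span_singleton_le_iff_mem _ _).2 hv)) ?_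
  have : U < U ⊔ F ∙ v := lt_of_le_of_ne le_sup_left fun he =>
    hv' (he ▸ (le_sup_right : F ∙ v ≤ _) (mem_span_singleton_self v))
  have := finrank_lt_finrank_of_lt this
  omega

theorem exists_mem_notMem_of_finrank_lt {U V : Submodule F L} [FiniteDimensional F L]
    (h : finrank F U < finrank F V) : ∃ v ∈ V, v ∉ U :=
  SetLike.not_le_iff_exists.1 fun hle => absurd (finrank_mono hle) (by omega)

/-- The alternating form $(v,w)\mapsto(xv,w)$ is nonzero, hence of rank at least $2$. -/
theorem exists_linearIndependent_mul (A : SympAltAlg F L) {x : L} (hx1 : x ∉ A.upper 1) :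
    ∃ v w, LinearIndependent F ![A.mul x v, A.mul x w] := by
  rw [mem_upper_one] at hx1
  push Not at hx1
  obtain ⟨v, hv⟩ := hx1
  obtain ⟨w, hw⟩ : ∃ w, A.form (A.mul x v) w ≠ 0 := by
    by_contra! hc
    exact hv (A.form_nondegenerate _ hc)
  refine ⟨v, w, LinearIndependent.pair_iff.2 fun a b hab => ?_⟩
  have h1 := congrArg (fun t => A.form t w) hab
  have h2 := congrArg (fun t => A.form t v) hab
  simp only [map_add, map_smul, LinearMap.add_apply, LinearMap.smul_apply, A.form_mul_self_right,
    smul_eq_mul, mul_zero, add_zero, zero_add, map_zero, LinearMap.zero_apply] at h1 h2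
  rw [A.form_mul_swap_right] at h2
  exact ⟨by simpa [hw] using h1, by simpa [hw] using h2⟩

namespace IsClass38

variable {A : SympAltAlg F L} (h : A.IsClass38)
include h

theorem finiteDimensional : FiniteDimensional F L :=
  FiniteDimensional.of_finrank_pos (by rw [h.finrank_eq]; norm_num)

theorem finrank_pow_two : finrank F (A.pow 2) = 7 := by
  have := h.finiteDimensional
  have := A.finrank_upper 1
  rw [h.finrank_upper_one, h.finrank_eq] at this
  simpa using (by omega : finrank F (A.pow (1 + 1)) = 7)

theorem finrank_upper_two : finrank F (A.upper 2) = 4 := by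
  have := h.finiteDimensional
  have := A.finrank_upper 2
  rw [h.finrank_pow_three, h.finrank_eq] at this
  omega

theorem upper_one_le_pow_two : A.upper 1 ≤ A.pow 2 := by
  have := h.finiteDimensional
  rw [← A.perp_upper 1]
  exact fun z hz => mem_perp.2 fun u hu => h.isotropic u hu z hz

/-- A central $z$ outside $L^3$ would give $L^2=L^3+\mathbb Fz$, hence $L^3=L^2L=L^3L=L^4$, against
nilpotency. -/
theorem upper_one_le_pow_three : A.upper 1 ≤ A.pow 3 := by
  have := h.finiteDimensional
  intro z hz
  by_contra hz3
  have h2 : A.pow 3 ⊔ F ∙ z = A.pow 2 := sup_span_singleton_eq (A.pow_succ_le 2)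
    (h.upper_one_le_pow_two hz) hz3 (by rw [h.finrank_pow_two, h.finrank_pow_three])
  have h3 : A.pow 3 = ⊥ := by
    refine A.pow_eq_bot_of_le h.nilpotent (k := 2) (A.prod_le fun u hu v _ => ?_)
    change u ∈ A.pow 2 at hu
    rw [← h2] at hu
    obtain ⟨a, ha, b, hb, rfl⟩ := mem_sup.1 hu
    obtain ⟨c, rfl⟩ := mem_span_singleton.1 hb
    rw [map_add, LinearMap.add_apply, map_smul, LinearMap.smul_apply, A.mem_upper_one.1 hz v,
      smul_zero, add_zero]
    exact A.mul_mem_pow_succ ha v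
  have := h.finrank_pow_three
  rw [h3, finrank_bot] at this
  omega

theorem upper_two_le_pow_two : A.upper 2 ≤ A.pow 2 := by
  have := h.finiteDimensional
  rw [← A.perp_upper 1, upper_eq_perp]
  exact A.perp_anti h.upper_one_le_pow_three

/-- $Z_2$ is isotropic: it is $Z_1$ plus one vector, and $Z_1$ is orthogonal to $L^2\ge Z_2$. Hence
$Z_2\le Z_2^\perp=L^3$. -/
theorem upper_two_le_pow_three : A.upper 2 ≤ A.pow 3 := by
  have := h.finiteDimensional
  obtain ⟨x, hx, hx1⟩ := exists_mem_notMem_of_finrank_lt (U := A.upper 1) (V := A.upper 2)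
    (by rw [h.finrank_upper_two, h.finrank_upper_one]; norm_num)
  have h2 : A.upper 1 ⊔ F ∙ x = A.upper 2 := sup_span_singleton_eq (A.upper_mono one_le_two)
    hx hx1 (by rw [h.finrank_upper_two, h.finrank_upper_one])
  rw [← A.perp_upper 2]
  refine fun u hu => mem_perp'.2 fun w hw => ?_
  have hxz : ∀ z ∈ A.upper 1, ∀ y ∈ A.upper 2, A.form z y = 0 := fun z hz y hy =>
    A.form_upper_pow hz (h.upper_two_le_pow_two hy)
  rw [← h2] at hu hw
  obtain ⟨a, ha, b, hb, rfl⟩ := mem_sup.1 hu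
  obtain ⟨c, rfl⟩ := mem_span_singleton.1 hb
  obtain ⟨a', ha', b', hb', rfl⟩ := mem_sup.1 hw
  obtain ⟨c', rfl⟩ := mem_span_singleton.1 hb'
  have e1 := hxz a ha _ (A.upper_mono one_le_two ha')
  have e2 := hxz a ha x hx
  have e3 := hxz a' ha' x hx
  simp [A.form_self, A.form_skew x a', e1, e2, e3]

theorem pow_four_sup_le : A.pow 4 ⊔ A.upper 2 ≤ A.pow 3 :=
  sup_le (A.pow_succ_le 3) h.upper_two_le_pow_three

/-- Equality would give $L^4\le L^5+Z_1$, then $L^5\le L^6$, so $L^5=0$. Then $L^4\le Z_1$ and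
$L^3\le Z_2$, impossible as $6>4$. -/
theorem pow_four_sup_ne : A.pow 4 ⊔ A.upper 2 ≠ A.pow 3 := by
  have := h.finiteDimensional
  intro he
  have h45 : A.pow 4 ≤ A.pow 5 ⊔ A.upper 1 := by
    refine A.prod_le fun u hu v _ => ?_
    change u ∈ A.pow 3 at hu
    rw [← he] at hu
    obtain ⟨a, ha, b, hb, rfl⟩ := mem_sup.1 hu
    rw [map_add, LinearMap.add_apply]
    exact add_mem (mem_sup_left (A.mul_mem_pow_succ ha v)) (mem_sup_right (hb v))
  have h56 : A.pow 5 = ⊥ := by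
    refine A.pow_eq_bot_of_le h.nilpotent (k := 4) (A.prod_le fun u hu v _ => ?_)
    obtain ⟨a, ha, b, hb, rfl⟩ := mem_sup.1 (h45 hu)
    rw [map_add, LinearMap.add_apply, A.mem_upper_one.1 hb, add_zero]
    exact A.mul_mem_pow_succ ha v
  rw [h56, bot_sup_eq] at h45
  have : A.pow 3 ≤ A.upper 2 := fun u hu v => h45 (A.mul_mem_pow_succ hu v)
  have := finrank_mono this
  rw [h.finrank_pow_three, h.finrank_upper_two] at this
  omega

/-- `L^3·L^3 = 0`. -/
theorem mul_pow_three {u v : L} (hu : u ∈ A.pow 3) (hv : v ∈ A.pow 3) : A.mul u v = 0 := by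
  have := h.finiteDimensional
  have hKlt : finrank F ↥(A.pow 4 ⊔ A.upper 2) < 6 := by
    rw [← h.finrank_pow_three]
    exact finrank_lt_finrank_of_lt (lt_of_le_of_ne h.pow_four_sup_le h.pow_four_sup_ne)
  -- As $\dim(L^4+Z_2)\le5$, one vector $x$ beyond $Z_2$ suffices to contain $L^4$. With a further
  -- $y$, $L^3=Z_2+\mathbb Fx+\mathbb Fy$, and $Z_2$ annihilates $L^3$, so only $xy$ matters.
  have hx : ∃ x ∈ A.pow 3, x ∉ A.upper 2 ∧ A.pow 4 ⊔ A.upper 2 ≤ A.upper 2 ⊔ F ∙ x := by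
    by_cases hle : A.pow 4 ⊔ A.upper 2 ≤ A.upper 2
    · obtain ⟨x, hx, hx2⟩ := exists_mem_notMem_of_finrank_lt (U := A.upper 2) (V := A.pow 3)
        (by rw [h.finrank_upper_two, h.finrank_pow_three]; norm_num)
      exact ⟨x, hx, hx2, hle.trans le_sup_left⟩
    · obtain ⟨x, hx, hx2⟩ := SetLike.not_le_iff_exists.1 hle
      refine ⟨x, h.pow_four_sup_le hx, hx2, ?_⟩
      rw [sup_span_singleton_eq le_sup_right hx hx2 (by rw [h.finrank_upper_two]; omega)]
  obtain ⟨x, hx, hx2, hxK⟩ := hx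
  have hU : finrank F ↥(A.upper 2 ⊔ F ∙ x) ≤ 5 := by
    refine (finrank_add_le_finrank_add_finrank _ _).trans ?_
    rw [h.finrank_upper_two]
    have := finrank_span_singleton (K := F) (v := x) (by rintro rfl; exact hx2 (zero_mem _))
    omega
  have hUle : A.upper 2 ⊔ F ∙ x ≤ A.pow 3 :=
    sup_le h.upper_two_le_pow_three ((span_singleton_le_iff_mem _ _).2 hx)
  obtain ⟨y, hy, hyU⟩ := exists_mem_notMem_of_finrank_lt (U := A.upper 2 ⊔ F ∙ x) (V := A.pow 3)
        (by rw [h.finrank_pow_three]; omega)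
  have h5 : 4 < finrank F ↥(A.upper 2 ⊔ F ∙ x) := by
    rw [← h.finrank_upper_two]
    refine finrank_lt_finrank_of_lt (lt_of_le_of_ne le_sup_left fun he => hx2 ?_)
    rw [he]; exact mem_sup_right (mem_span_singleton_self x)
  have h3 := sup_span_singleton_eq hUle hy hyU (by rw [h.finrank_pow_three]; omega)
  -- $(xy,w)=(yw,x)$ with $yw\in L^4\le Z_2+\mathbb Fx$, and both summands are orthogonal to $x$.
  have hxy : A.mul x y = 0 := by
    refine A.form_nondegenerate _ fun w => ?_
    have hyw : A.mul y w ∈ A.upper 2 ⊔ F ∙ x := hxK (mem_sup_left (A.mul_mem_pow_succ hy w))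
    obtain ⟨z, hz, b, hb, he⟩ := mem_sup.1 hyw
    obtain ⟨c, rfl⟩ := mem_span_singleton.1 hb
    rw [A.form_mul, ← he, map_add, LinearMap.add_apply, A.form_upper_pow hz hx]
    simp [A.form_self]
  have hz2 : ∀ z ∈ A.upper 2, ∀ w ∈ A.pow 3, A.mul z w = 0 := fun z hz w hw =>
    A.mul_upper_pow hz (A.pow_succ_le 2 hw)
  rw [← h3] at hu hv
  obtain ⟨a, ha, b, hb, rfl⟩ := mem_sup.1 hu
  obtain ⟨z, hz, d, hd, rfl⟩ := mem_sup.1 ha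
  obtain ⟨c, rfl⟩ := mem_span_singleton.1 hb
  obtain ⟨e, rfl⟩ := mem_span_singleton.1 hd
  obtain ⟨a', ha', b', hb', rfl⟩ := mem_sup.1 hv
  obtain ⟨z', hz', d', hd', rfl⟩ := mem_sup.1 ha'
  obtain ⟨c', rfl⟩ := mem_span_singleton.1 hb'
  obtain ⟨e', rfl⟩ := mem_span_singleton.1 hd'
  have e1 : A.mul x z' = 0 := by rw [A.mul_skew, hz2 z' hz' x hx, neg_zero]
  have e2 : A.mul y z' = 0 := by rw [A.mul_skew, hz2 z' hz' y hy, neg_zero]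
  have e3 : A.mul y x = 0 := by rw [A.mul_skew, hxy, neg_zero]
  simp only [map_add, LinearMap.add_apply, map_smul, LinearMap.smul_apply]
  simp [e1, e2, e3, hz2 z hz _ (h.upper_two_le_pow_three hz'), hz2 z hz _ hx,
    hz2 z hz _ hy, hxy, A.mul_self]

/-- An element that annihilates `L^3` lies in `L^2`. -/
theorem mem_pow_two_of_mul_pow_three {y : L} (hy : ∀ u ∈ A.pow 3, A.mul u y = 0) :
    y ∈ A.pow 2 := by
  have := h.finiteDimensional
  by_contra hy2
  -- $N$ has dimension at least $7$ and $NN=0$. Modulo the centre, $n\in N$ is determined by the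
  -- alternating form $(nc,d)$ on a complement $C$ of dimension at most $3$, that is by three
  -- scalars. So at least four dimensions of $N$ would be central.
  set N := A.pow 3 ⊔ F ∙ y with hN
  have hNN : ∀ n ∈ N, ∀ m ∈ N, A.mul n m = 0 := by
    intro n hn m hm
    obtain ⟨a, ha, b, hb, rfl⟩ := mem_sup.1 hn
    obtain ⟨c, rfl⟩ := mem_span_singleton.1 hb
    obtain ⟨a', ha', b', hb', rfl⟩ := mem_sup.1 hm
    obtain ⟨c', rfl⟩ := mem_span_singleton.1 hb'
    have e : A.mul y a' = 0 := by rw [A.mul_skew, hy a' ha', neg_zero]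
    simp [h.mul_pow_three ha ha', hy a ha, e, A.mul_self]
  have hy3 : y ∉ A.pow 3 := fun hy' => hy2 (A.pow_succ_le 2 hy')
  have hfN : 6 < finrank F N := by
    rw [← h.finrank_pow_three]
    refine finrank_lt_finrank_of_lt (lt_of_le_of_ne le_sup_left fun he => hy3 ?_)
    rw [he]; exact mem_sup_right (mem_span_singleton_self y)
  obtain ⟨C, hC⟩ := N.exists_isCompl
  have hfC : finrank F C ≤ 3 := by
    have := finrank_add_eq_of_isCompl hC
    rw [h.finrank_eq] at this
    omega
  obtain ⟨e, he⟩ : ∃ e : Fin 3 → L, C ≤ span F (Set.range e) := by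
    let b := Module.finBasis F C
    -- Only $\dim C\le3$ is known, so a basis of $C$ is padded with zeros.
    refine ⟨fun i => if hi : (i : ℕ) < finrank F C then b ⟨i, hi⟩ else 0, fun c hc => ?_⟩
    have := b.sum_repr ⟨c, hc⟩
    have h2 : c = ∑ i, b.repr ⟨c, hc⟩ i • (b i : L) := by
      conv_lhs => rw [show c = ((⟨c, hc⟩ : C) : L) from rfl, ← this]
      rw [coe_sum]
      rfl
    rw [h2]
    refine sum_mem fun i _ => smul_mem _ _ (subset_span ⟨⟨i, by omega⟩, by simp⟩)
  let T : N →ₗ[F] (Fin 3 → F) := LinearMap.pi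
    ![(A.form.flip (e 1) ∘ₗ A.mul.flip (e 0)) ∘ₗ N.subtype,
      (A.form.flip (e 2) ∘ₗ A.mul.flip (e 0)) ∘ₗ N.subtype,
      (A.form.flip (e 2) ∘ₗ A.mul.flip (e 1)) ∘ₗ N.subtype]
  have hker : (LinearMap.ker T).map N.subtype ≤ A.upper 1 := by
    rintro _ ⟨⟨n, hn⟩, hT, rfl⟩
    have hT' : ∀ i, T ⟨n, hn⟩ i = 0 := fun i => by rw [LinearMap.mem_ker.1 hT]; rfl
    have h01 : A.form (A.mul n (e 0)) (e 1) = 0 := hT' 0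
    have h02 : A.form (A.mul n (e 0)) (e 2) = 0 := hT' 1
    have h12 : A.form (A.mul n (e 1)) (e 2) = 0 := hT' 2
    have hee : ∀ i j, A.form (A.mul n (e i)) (e j) = 0 := by
      have h10 : A.form (A.mul n (e 1)) (e 0) = 0 := by
        rw [A.form_mul_swap_right, h01, neg_zero]
      have h20 : A.form (A.mul n (e 2)) (e 0) = 0 := by
        rw [A.form_mul_swap_right, h02, neg_zero]
      have h21 : A.form (A.mul n (e 2)) (e 1) = 0 := by
        rw [A.form_mul_swap_right, h12, neg_zero]
      intro i j
      fin_cases i <;> fin_cases j <;> first | assumption | exact A.form_mul_self_right _ _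
    have hCC : ∀ c ∈ C, ∀ d ∈ C, A.form (A.mul n c) d = 0 := by
      intro c hc d hd
      have h1 : ∀ j, ∀ c ∈ span F (Set.range e), A.form (A.mul n c) (e j) = 0 := by
        intro j
        have : span F (Set.range e) ≤ LinearMap.ker (A.form.flip (e j) ∘ₗ A.mul n) := by
          rw [span_le]; rintro _ ⟨i, rfl⟩; exact hee i j
        exact fun c hc => this hc
      have h2 : span F (Set.range e) ≤ LinearMap.ker (A.form (A.mul n c)) := by
        rw [span_le]; rintro _ ⟨j, rfl⟩; exact h1 j c (he hc)
      exact h2 (he hd)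
    refine A.mem_upper_one.2 fun v => A.form_nondegenerate _ fun w => ?_
    have hv : v ∈ N ⊔ C := by rw [hC.sup_eq_top]; trivial
    have hw : w ∈ N ⊔ C := by rw [hC.sup_eq_top]; trivial
    obtain ⟨a, ha, c, hc, rfl⟩ := mem_sup.1 hv
    obtain ⟨b, hb, d, hd, rfl⟩ := mem_sup.1 hw
    have e3 : A.form (A.mul n c) b = 0 := by
      rw [A.form_mul_swap_right, hNN n hn b hb]; simp
    simp [hNN n hn a ha, e3, hCC c hc d hd]
  have h1 := finrank_mono hker
  rw [finrank_map_subtype_eq, h.finrank_upper_one] at h1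
  have h2 := LinearMap.finrank_range_add_finrank_ker T
  have h3 := finrank_le (LinearMap.range T)
  rw [finrank_fin_fun] at h3
  omega

/-- $Z_3$ annihilates $L^3$, so it lies in $L^2$. An element $y\in Z_3$ outside $L^3$ would give
$L^3=(L^3+\mathbb Fy)L\le L^4+Z_2$, excluded by `pow_four_sup_ne`. -/
theorem upper_three_le_pow_three : A.upper 3 ≤ A.pow 3 := by
  have := h.finiteDimensional
  intro y hy
  by_contra hy3
  have hy2 : y ∈ A.pow 2 := h.mem_pow_two_of_mul_pow_three fun u hu => by
    rw [A.mul_skew, A.mul_upper_pow hy hu, neg_zero]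
  have h2 : A.pow 3 ⊔ F ∙ y = A.pow 2 := sup_span_singleton_eq (A.pow_succ_le 2) hy2 hy3
    (by rw [h.finrank_pow_two, h.finrank_pow_three])
  refine h.pow_four_sup_ne (le_antisymm h.pow_four_sup_le (A.prod_le fun u hu v _ => ?_))
  change u ∈ A.pow 2 at hu
  rw [← h2] at hu
  obtain ⟨a, ha, b, hb, rfl⟩ := mem_sup.1 hu
  obtain ⟨c, rfl⟩ := mem_span_singleton.1 hb
  rw [map_add, LinearMap.add_apply, map_smul, LinearMap.smul_apply]
  exact add_mem (mem_sup_left (A.mul_mem_pow_succ ha v)) (mem_sup_right (smul_mem _ _ (hy v)))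

theorem upper_two_le_pow_four : A.upper 2 ≤ A.pow 4 := by
  have := h.finiteDimensional
  rw [upper_eq_perp, ← A.perp_upper 3]
  exact A.perp_anti h.upper_three_le_pow_three

/-- `L^5 = L^3·y₂` for every `y₂ ∈ L^2 \ L^3`. -/
theorem map_mul_pow_three {y : L} (hy : y ∈ A.pow 2) (hy3 : y ∉ A.pow 3) :
    (A.pow 3).map (A.mul.flip y) = A.pow 5 := by
  have := h.finiteDimensional
  rw [← h.prod_eq]
  refine le_antisymm ?_ (A.prod_le fun u hu v hv => ?_)
  · rintro _ ⟨u, hu, rfl⟩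
    exact A.mul_mem_prod hu hy
  · rw [← sup_span_singleton_eq (A.pow_succ_le 2) hy hy3
      (by rw [h.finrank_pow_two, h.finrank_pow_three])] at hv
    obtain ⟨a, ha, b, hb, rfl⟩ := mem_sup.1 hv
    obtain ⟨c, rfl⟩ := mem_span_singleton.1 hb
    rw [map_add, h.mul_pow_three hu ha, zero_add, map_smul]
    exact smul_mem _ _ ⟨u, hu, rfl⟩

theorem exists_mem_pow_two_notMem : ∃ y ∈ A.pow 2, y ∉ A.pow 3 := by
  have := h.finiteDimensional
  exact exists_mem_notMem_of_finrank_lt (by rw [h.finrank_pow_two, h.finrank_pow_three]; norm_num)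

/-- Multiplication by $y_2$ maps $L^3$ onto $L^5$ and kills the four-dimensional $Z_2$. -/
theorem finrank_pow_five_le : finrank F (A.pow 5) ≤ 2 := by
  have := h.finiteDimensional
  obtain ⟨y, hy, hy3⟩ := h.exists_mem_pow_two_notMem
  rw [← h.map_mul_pow_three hy hy3]
  have h1 := LinearMap.finrank_range_add_finrank_ker ((A.mul.flip y).domRestrict (A.pow 3))
  rw [LinearMap.range_domRestrict, h.finrank_pow_three] at h1
  have h2 : (A.upper 2) ≤ (LinearMap.ker ((A.mul.flip y).domRestrict (A.pow 3))).map
      (A.pow 3).subtype := fun z hz =>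
    ⟨⟨z, h.upper_two_le_pow_three hz⟩, A.mul_upper_pow hz hy, rfl⟩
  have h3 := finrank_mono h2
  rw [finrank_map_subtype_eq, h.finrank_upper_two] at h3
  omega

theorem exists_mem_upper_two_notMem : ∃ x ∈ A.upper 2, x ∉ A.upper 1 := by
  have := h.finiteDimensional
  exact exists_mem_notMem_of_finrank_lt
    (by rw [h.finrank_upper_two, h.finrank_upper_one]; norm_num)

/-- Since $x\in Z_2\le L^4$, these products lie in both $L^5$ and $Z_1$; this gives the exact
dimension of $L^5$ and its centrality. -/
theorem pow_five_eq_span {x v w : L} (hx : x ∈ A.upper 2)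
    (hvw : LinearIndependent F ![A.mul x v, A.mul x w]) :
    span F (Set.range ![A.mul x v, A.mul x w]) = A.pow 5 := by
  have := h.finiteDimensional
  refine eq_of_le_of_finrank_le ?_ ?_
  · rw [span_le]
    rintro _ ⟨i, rfl⟩
    have hx4 := h.upper_two_le_pow_four hx
    fin_cases i
    · exact A.mul_mem_pow_succ hx4 v
    · exact A.mul_mem_pow_succ hx4 w
  · rw [finrank_span_eq_card hvw, Fintype.card_fin]
    exact h.finrank_pow_five_le

theorem finrank_pow_five : finrank F (A.pow 5) = 2 := by
  obtain ⟨x, hx, hx1⟩ := h.exists_mem_upper_two_notMem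
  obtain ⟨v, w, hvw⟩ := A.exists_linearIndependent_mul hx1
  rw [← h.pow_five_eq_span hx hvw, finrank_span_eq_card hvw, Fintype.card_fin]

theorem pow_five_le_upper_one : A.pow 5 ≤ A.upper 1 := by
  obtain ⟨x, hx, hx1⟩ := h.exists_mem_upper_two_notMem
  obtain ⟨v, w, hvw⟩ := A.exists_linearIndependent_mul hx1
  rw [← h.pow_five_eq_span hx hvw, span_le]
  rintro _ ⟨i, rfl⟩
  fin_cases i
  · exact hx v
  · exact hx w

theorem pow_four_eq : A.pow 4 = A.upper 2 :=
  le_antisymm (fun _ hu v => h.pow_five_le_upper_one (A.mul_mem_pow_succ hu v))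
    h.upper_two_le_pow_four

theorem finrank_upper_four : finrank F (A.upper 4) = 8 := by
  have := h.finiteDimensional
  have := A.finrank_upper 4
  rw [h.finrank_pow_five, h.finrank_eq] at this
  omega

theorem pow_two_le_upper_four : A.pow 2 ≤ A.upper 4 := by
  have := h.finiteDimensional
  rw [← A.perp_upper 1, A.upper_eq_perp 4]
  exact A.perp_anti h.pow_five_le_upper_one

/-- $L^5=Z_4^\perp$ and $Z_4=L^2+\mathbb Fy$. Here $(uy,y)=0$, and $(uy,a)=-(ua,y)=0$ for $a\in L^2$
because $ua\in L^5$. -/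
theorem mul_pow_three_upper_four {u y : L} (hu : u ∈ A.pow 3) (hy : y ∈ A.upper 4) :
    A.mul u y ∈ A.pow 5 := by
  have := h.finiteDimensional
  by_cases hy2 : y ∈ A.pow 2
  · rw [← h.prod_eq]; exact A.mul_mem_prod hu hy2
  rw [← A.perp_upper 4]
  refine mem_perp'.2 fun w hw => ?_
  rw [← sup_span_singleton_eq h.pow_two_le_upper_four hy hy2
    (by rw [h.finrank_upper_four, h.finrank_pow_two])] at hw
  obtain ⟨a, ha, b, hb, rfl⟩ := mem_sup.1 hw
  obtain ⟨c, rfl⟩ := mem_span_singleton.1 hb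
  have h5 : A.mul u a ∈ A.pow 5 := by rw [← h.prod_eq]; exact A.mul_mem_prod hu ha
  rw [map_add, map_smul, A.form_mul_self_right, smul_zero, add_zero, A.form_mul_swap_right,
    A.form_skew, A.form_upper_pow hy h5, neg_zero, neg_zero]

end IsClass38

end Structure
end SympAltAlg

namespace SympAltAlg

/-! ### Central corrections and standard bases -/

section StandardBasis

open Module Submodule

variable {F : Type*} [Field F] {L : Type*} [AddCommGroup L] [Module F L] (A : SympAltAlg F L)

theorem form_eq_neg {A : SympAltAlg F L} {x y : L} {c : F} (h : A.form x y = c) :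
    A.form y x = -c := by
  rw [A.form_skew, h]

theorem mul_eq_zero_symm {A : SympAltAlg F L} {x y : L} (h : A.mul x y = 0) :
    A.mul y x = 0 := by
  rw [A.mul_skew, h, neg_zero]

theorem mul_center_right {z : L} (hz : z ∈ A.upper 1) (v : L) : A.mul v z = 0 :=
  mul_eq_zero_symm (A.mem_upper_one.1 hz v)

theorem mul_eq_of_sub_mem_center {a a' b b' : L} (ha : a' - a ∈ A.upper 1)
    (hb : b' - b ∈ A.upper 1) : A.mul a' b' = A.mul a b := by
  have h1 := A.mem_upper_one.1 ha b'
  have h2 := A.mul_center_right hb a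
  rw [map_sub, LinearMap.sub_apply, sub_eq_zero] at h1
  rw [map_sub, sub_eq_zero] at h2
  rw [h1, h2]

theorem form_mul_center {z : L} (hz : z ∈ A.upper 1) (a b : L) : A.form (A.mul a b) z = 0 := by
  rw [A.form_mul, A.mul_center_right hz, map_zero, LinearMap.zero_apply]

theorem form_mul_eq_of_sub_mem_center {a a' b b' c c' : L} (ha : a' - a ∈ A.upper 1)
    (hb : b' - b ∈ A.upper 1) (hc : c' - c ∈ A.upper 1) :
    A.form (A.mul a' b') c' = A.form (A.mul a b) c := by
  rw [A.mul_eq_of_sub_mem_center ha hb, ← sub_eq_zero, ← map_sub, A.form_mul_center hc]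

/-- Families with the Gram matrix of a standard basis form a standard basis. -/
theorem exists_isStandardBasis [FiniteDimensional F L] {n : ℕ} (hd : finrank F L = 2 * n)
    {x y : Fin n → L} (hxx : ∀ i j, A.form (x i) (x j) = 0) (hyy : ∀ i j, A.form (y i) (y j) = 0)
    (hxy : ∀ i j, A.form (x i) (y j) = if i = j then 1 else 0) :
    ∃ b : Basis (Fin n ⊕ Fin n) F L, A.IsStandardBasis b ∧
      (∀ i, b (Sum.inl i) = x i) ∧ ∀ i, b (Sum.inr i) = y i := by
  have hyx : ∀ i j, A.form (y i) (x j) = if j = i then -1 else 0 := fun i j => by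
    rw [A.form_skew, hxy]; split_ifs <;> simp
  have hli : LinearIndependent F (Sum.elim x y) := by
    refine Fintype.linearIndependent_iff.2 fun g hg => ?_
    rw [Fintype.sum_sum_type] at hg
    simp only [Sum.elim_inl, Sum.elim_inr] at hg
    rintro (j | j)
    · have := congrArg (fun t => A.form t (y j)) hg
      simpa [hxy, hyy, LinearMap.sum_apply] using this
    · have := congrArg (fun t => A.form t (x j)) hg
      simpa [hxx, hyx, LinearMap.sum_apply] using this
  have hcard : Fintype.card (Fin n ⊕ Fin n) = finrank F L := by simp [hd]; omega
  rcases isEmpty_or_nonempty (Fin n ⊕ Fin n) with hem | hne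
  · have : Subsingleton L := finrank_zero_iff.1 (by rw [← hcard]; simp)
    refine ⟨Basis.empty L, ⟨?_, ?_, ?_⟩, ?_, ?_⟩ <;> intro i <;> exact hem.elim (Sum.inl i)
  · refine ⟨basisOfLinearIndependentOfCardEqFinrank hli hcard, ⟨?_, ?_, ?_⟩, ?_, ?_⟩ <;>
      simp [hxx, hyy, hxy]

/-- Vectors that form a symplectic basis modulo the centre can be corrected by central elements to
a standard basis. -/
theorem exists_standard_of_mod_center (h2 : (2 : F) ≠ 0) (hiso : A.IsIsotropic (A.upper 1))
    {x₁ x₂ y₁ y₂ : L} (hx₁ : x₁ ∈ A.pow 2) (hx₂ : x₂ ∈ A.pow 2) (hy₁ : y₁ ∈ A.pow 2)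
    (hy₂ : y₂ ∈ A.pow 2) (hxx : A.form x₁ x₂ = 0) (hyy : A.form y₁ y₂ = 0)
    (h11 : A.form x₁ y₁ = 1) (h12 : A.form x₁ y₂ = 0) (h21 : A.form x₂ y₁ = 0)
    (h22 : A.form x₂ y₂ = 1) {z w : Fin 3 → L} (hz : ∀ i, z i ∈ A.upper 1)
    (hzw : ∀ i j, A.form (z i) (w j) = if i = j then 1 else 0) :
    ∃ x y : Fin 5 → L, (∀ i j, A.form (x i) (x j) = 0) ∧ (∀ i j, A.form (y i) (y j) = 0) ∧
      (∀ i j, A.form (x i) (y j) = if i = j then 1 else 0) ∧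
      x 0 - x₁ ∈ A.upper 1 ∧ x 1 - x₂ ∈ A.upper 1 ∧
      x 2 ∈ A.upper 1 ∧ x 3 ∈ A.upper 1 ∧ x 4 ∈ A.upper 1 ∧
      y 0 - y₁ ∈ A.upper 1 ∧ y 1 - y₂ ∈ A.upper 1 ∧ y 2 - w 0 ∈ A.upper 1 ∧
      y 3 - w 1 ∈ A.upper 1 ∧ y 4 - w 2 ∈ A.upper 1 := by
  have hzz : ∀ i j, A.form (z i) (z j) = 0 := fun i j => hiso _ (hz i) _ (hz j)
  have hwz : ∀ i j, A.form (w i) (z j) = if j = i then -1 else 0 := fun i j => by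
    rw [A.form_skew, hzw]; split_ifs <;> simp
  -- Both arguments of $(w_i',w_j')$ contribute $-\frac12(w_i,w_j)$, which cancels $(w_i,w_j)$; this
  -- needs characteristic not $2$.
  let w' : Fin 3 → L := fun i => w i + ∑ j, ((2 : F)⁻¹ * A.form (w j) (w i)) • z j
  have hw'w' : ∀ i j, A.form (w' i) (w' j) = 0 := fun i j => by
    have : A.form (w j) (w i) = -A.form (w i) (w j) := A.form_skew _ _
    simp only [w', map_add, map_sum, map_smul, LinearMap.add_apply, LinearMap.sum_apply,
      LinearMap.smul_apply, hzz, hzw, hwz, smul_eq_mul, mul_ite, mul_one, mul_zero,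
      Finset.sum_ite_eq', Finset.mem_univ, if_true, Finset.sum_const_zero,
      add_zero, mul_neg]
    rw [this]
    field_simp
    ring
  have hzw' : ∀ i j, A.form (z i) (w' j) = if i = j then 1 else 0 := fun i j => by
    simp [w', hzw, hzz]
  have hw'z : ∀ i j, A.form (w' i) (z j) = if j = i then -1 else 0 := fun i j => by
    rw [A.form_skew, hzw']; split_ifs <;> simp
  -- Subtracting this central part makes $u$ orthogonal to every $w_j'$. Forms between elements of
  -- $L^2$ are unaffected, because $L^2$ is orthogonal to the centre.
  let k : L → L := fun u => ∑ j, A.form u (w' j) • z j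
  let c : L → L := fun u => u - k u
  have hk : ∀ u, k u ∈ A.upper 1 := fun u => sum_mem fun j _ => smul_mem _ _ (hz j)
  have hc : ∀ u, c u - u ∈ A.upper 1 := fun u => by
    simpa [c] using hk u
  have hcz : ∀ u ∈ A.pow 2, ∀ t ∈ A.upper 1, A.form (c u) t = 0 := fun u hu t ht => by
    simp only [c, map_sub, LinearMap.sub_apply]
    rw [hiso _ (hk u) _ ht, form_eq_neg (A.form_upper_pow ht hu)]; simp
  have hcc : ∀ u ∈ A.pow 2, ∀ v ∈ A.pow 2, A.form (c u) (c v) = A.form u v := fun u hu v hv => by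
    have e : A.form (c u) (k v) = 0 := hcz u hu _ (hk v)
    have e' : A.form (k u) v = 0 := A.form_upper_pow (hk u) hv
    rw [show c v = v - k v from rfl, map_sub, e, sub_zero, show c u = u - k u from rfl, map_sub,
      LinearMap.sub_apply, e', sub_zero]
  have hcw : ∀ u j, A.form (c u) (w' j) = 0 := fun u j => by
    simp [c, k, hzw', LinearMap.sum_apply]
  have hw' : ∀ i, w' i - w i ∈ A.upper 1 := fun i => by
    simpa [w'] using sum_mem fun j _ => smul_mem _ _ (hz j)
  refine ⟨![c x₁, c x₂, z 0, z 1, z 2], ![c y₁, c y₂, w' 0, w' 1, w' 2], ?_, ?_, ?_, hc _, hc _,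
    hz _, hz _, hz _, hc _, hc _, hw' _, hw' _, hw' _⟩
  · have hcz' : ∀ u ∈ A.pow 2, ∀ j, A.form (z j) (c u) = 0 := fun u hu j => by
      rw [A.form_skew, hcz u hu _ (hz j), neg_zero]
    simp [Fin.forall_fin_succ, hzz, hcz x₁ hx₁ _ (hz _), hcz x₂ hx₂ _ (hz _), hcz' x₁ hx₁,
      hcz' x₂ hx₂, A.form_self, hcc x₁ hx₁ x₂ hx₂, hcc x₂ hx₂ x₁ hx₁, hxx, form_eq_neg hxx]
  · have hcw' : ∀ u j, A.form (w' j) (c u) = 0 := fun u j => by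
      rw [A.form_skew, hcw, neg_zero]
    simp [Fin.forall_fin_succ, hw'w', hcw, hcw', A.form_self, hcc y₁ hy₁ y₂ hy₂,
      hcc y₂ hy₂ y₁ hy₁, hyy, form_eq_neg hyy]
  · have hcz' : ∀ u ∈ A.pow 2, ∀ j, A.form (z j) (c u) = 0 := fun u hu j => by
      rw [A.form_skew, hcz u hu _ (hz j), neg_zero]
    intro i j
    fin_cases i <;> fin_cases j <;> first
      | exact (hcc x₁ hx₁ y₁ hy₁).trans h11
      | exact (hcc x₁ hx₁ y₂ hy₂).trans h12
      | exact (hcc x₂ hx₂ y₁ hy₁).trans h21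
      | exact (hcc x₂ hx₂ y₂ hy₂).trans h22
      | exact hcw _ _
      | exact hcz' _ hy₁ _
      | exact hcz' _ hy₂ _
      | exact hzw' _ _

/-- The hypotheses are a checklist: the vanishing products and the central $x_3,x_4,x_5$ dispose of
every triple not listed individually. -/
theorem hasPresentation_P38 [FiniteDimensional F L] (hd : finrank F L = 10) {r s : F}
    {x y : Fin 5 → L}
    (hxx : ∀ i j, A.form (x i) (x j) = 0) (hyy : ∀ i j, A.form (y i) (y j) = 0)
    (hxy : ∀ i j, A.form (x i) (y j) = if i = j then 1 else 0)
    (hx2 : x 2 ∈ A.upper 1) (hx3 : x 3 ∈ A.upper 1) (hx4 : x 4 ∈ A.upper 1)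
    (m01 : A.mul (x 0) (x 1) = 0) (n00 : A.mul (x 0) (y 0) = 0) (n10 : A.mul (x 1) (y 0) = 0)
    (n11 : A.mul (x 1) (y 1) = 0) (n12 : A.mul (x 1) (y 2) = 0)
    (p134 : A.form (A.mul (x 1) (y 3)) (y 4) = r)
    (p012 : A.form (A.mul (x 0) (y 1)) (y 2) = 0) (p013 : A.form (A.mul (x 0) (y 1)) (y 3) = 1)
    (p014 : A.form (A.mul (x 0) (y 1)) (y 4) = 0) (p023 : A.form (A.mul (x 0) (y 2)) (y 3) = 0)
    (p024 : A.form (A.mul (x 0) (y 2)) (y 4) = s) (p034 : A.form (A.mul (x 0) (y 3)) (y 4) = 0)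
    (q012 : A.form (A.mul (y 0) (y 1)) (y 2) = 0) (q013 : A.form (A.mul (y 0) (y 1)) (y 3) = 0)
    (q014 : A.form (A.mul (y 0) (y 1)) (y 4) = 1) (q023 : A.form (A.mul (y 0) (y 2)) (y 3) = 1)
    (q024 : A.form (A.mul (y 0) (y 2)) (y 4) = 0) (q034 : A.form (A.mul (y 0) (y 3)) (y 4) = 0)
    (q123 : A.form (A.mul (y 1) (y 2)) (y 3) = 0) (q124 : A.form (A.mul (y 1) (y 2)) (y 4) = 0)
    (q134 : A.form (A.mul (y 1) (y 3)) (y 4) = 0) (q234 : A.form (A.mul (y 2) (y 3)) (y 4) = 0) :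
    A.HasPresentation (NilpPres.P38 r s) := by
  obtain ⟨b, hb, hbx, hby⟩ := A.exists_isStandardBasis (n := 5) (by rw [hd]) hxx hyy hxy
  have hc2 := A.mem_upper_one.1 hx2
  have hc3 := A.mem_upper_one.1 hx3
  have hc4 := A.mem_upper_one.1 hx4
  have hc2' := A.mul_center_right hx2
  have hc3' := A.mul_center_right hx3
  have hc4' := A.mul_center_right hx4
  have m10 := mul_eq_zero_symm m01
  have hmxx : ∀ i j, A.mul (x i) (x j) = 0 := by
    simp [Fin.forall_fin_succ, hc2, hc3, hc4, hc2', hc3', hc4', m01, m10, A.mul_self]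
  refine ⟨b, hb, ?_, ?_, ?_, fun i j k => ?_, fun i j k => ?_⟩
  · intro i j k hij hjk
    rw [hbx, hby, hby]
    fin_cases i <;> fin_cases j <;> first | exact absurd hij (by decide) |
      (fin_cases k <;> first | exact absurd hjk (by decide) |
        simp [NilpPres.P38, hc2, n12, p134, p012, p013, p014, p023, p024, p034])
  · intro i j k hij hjk
    rw [hby, hby, hby]
    fin_cases i <;> fin_cases j <;> first | exact absurd hij (by decide) |
      (fin_cases k <;> first | exact absurd hjk (by decide) |
        simp [NilpPres.P38, q012, q013, q014, q023, q024, q034, q123, q124, q134, q234])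
  · intro i j k hij hjk
    rw [hbx, hby, hby]
    fin_cases i
    · fin_cases j <;> first | exact absurd hij (by decide) | simp [n00]
    · fin_cases j <;> first | exact absurd hij (by decide) | simp [n10, n11]
    · simp [hc2]
    · simp [hc3]
    · simp [hc4]
  · simp [hbx, hmxx]
  · simp [hbx, hmxx]

end StandardBasis
end SympAltAlg

namespace SympAltAlg

/-! ### The endomorphism $\tau$ and its normal form -/

section NormalForm

open Module Submodule

variable {F : Type*} [Field F] {L : Type*} [AddCommGroup L] [Module F L]

/-- An endomorphism of a plane with irreducible minimal polynomial is scalar, or differs by a scalar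
from a square root of a non-square scalar. -/
theorem exists_sq_eq_of_irreducible_minpoly {V : Type*} [AddCommGroup V] [Module F V]
    (h2 : (2 : F) ≠ 0) (hV : finrank F V = 2) (τ : Module.End F V)
    (hτ : Irreducible (minpoly F τ)) (hns : ∀ c : F, ∃ v, τ v ≠ c • v) :
    ∃ t s : F, ¬ IsSquare s ∧ ∀ v, τ (τ v - t • v) - t • (τ v - t • v) = s • v := by
  have : FiniteDimensional F V := FiniteDimensional.of_finrank_pos (by rw [hV]; norm_num)
  have hint : IsIntegral F τ := Algebra.IsIntegral.isIntegral τ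
  have hmon := minpoly.monic hint
  have hdeg : (minpoly F τ).natDegree ≤ 2 := by
    rw [← hV, ← LinearMap.charpoly_natDegree τ]
    exact Polynomial.natDegree_le_of_dvd (LinearMap.minpoly_dvd_charpoly τ)
      (LinearMap.charpoly_monic τ).ne_zero
  have hdeg1 : (minpoly F τ).degree ≠ 1 := by
    intro h1
    have h3 := minpoly.aeval F τ
    rw [Polynomial.eq_X_add_C_of_degree_eq_one h1, hmon.leadingCoeff] at h3
    obtain ⟨v, hv⟩ := hns (-(minpoly F τ).coeff 0)
    apply hv
    have h4 := LinearMap.congr_fun h3 v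
    simp [Module.algebraMap_end_apply] at h4
    rw [neg_smul, eq_neg_iff_add_eq_zero, h4]
  have hdeg2 : (minpoly F τ).natDegree = 2 := by
    have h0 : (minpoly F τ).natDegree ≠ 0 := hτ.natDegree_pos.ne'
    have h1 : (minpoly F τ).natDegree ≠ 1 := fun h =>
      hdeg1 ((Polynomial.degree_eq_iff_natDegree_eq_of_pos one_pos).2 h)
    omega
  obtain ⟨b, c, hbc⟩ : ∃ b c : F, minpoly F τ = Polynomial.X ^ 2 + Polynomial.C b * Polynomial.X
      + Polynomial.C c := by
    refine ⟨(minpoly F τ).coeff 1, (minpoly F τ).coeff 0, ?_⟩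
    have h3 := hmon.as_sum
    rw [hdeg2] at h3
    conv_lhs => rw [h3]
    simp [Finset.sum_range_succ]
    ring
  obtain ⟨k, rfl⟩ : ∃ k, b = 2 * k := ⟨b / 2, (mul_div_cancel₀ b h2).symm⟩
  -- Completing the square: $\tau^2+2k\tau+c=0$ reads $(\tau+k)^2=k^2-c$. If $k^2-c=a^2$, then $a-k$
  -- would be a root of the minimal polynomial.
  refine ⟨-k, k ^ 2 - c, ?_, fun v => ?_⟩
  · rintro ⟨a, ha⟩
    refine hdeg1 (Polynomial.degree_eq_one_of_irreducible_of_root hτ (x := a - k) ?_)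
    rw [hbc]
    simp only [Polynomial.IsRoot, Polynomial.eval_add, Polynomial.eval_mul, Polynomial.eval_pow,
      Polynomial.eval_X, Polynomial.eval_C]
    linear_combination -ha
  · have h3 := minpoly.aeval F τ
    rw [hbc] at h3
    have h4 := LinearMap.congr_fun h3 v
    simp only [map_add, map_mul, Polynomial.aeval_X, Polynomial.aeval_C, pow_two,
      Module.End.mul_apply, Module.algebraMap_end_apply, LinearMap.add_apply,
      LinearMap.zero_apply] at h4
    rw [map_sub, map_smul]
    rw [← sub_eq_zero, ← h4]
    module

namespace IsClass38

variable {A : SympAltAlg F L} (h : A.IsClass38)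
include h

/-- Type C speaks of every $\tau$ belonging to $y_2,y_3$, so one has to be produced. Both maps
vanish on $L^4$ since $(uy,v)=-(uv,y)$ with $uv\in L^5=Z_4^\perp$; $\phi$ is onto $L^5$, and both
planes have dimension $2$. The last clause is the working form $\tau(uy_2)=uy_3$. -/
theorem exists_tau {y₂ y₃ : L} (hy₂ : y₂ ∈ A.pow 2) (hy₂' : y₂ ∉ A.pow 3) (hy₃ : y₃ ∈ A.upper 4) :
    ∃ τ : Module.End F (A.pow 5), A.IsTau y₂ y₃ τ ∧ ∀ u ∈ A.pow 3, ∀ v w : A.pow 5,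
      (v : L) = A.mul u y₂ → (w : L) = A.mul u y₃ → τ v = w := by
  have := h.finiteDimensional
  have hmap : ∀ y ∈ A.upper 4, ∀ u : A.pow 3, (A.mul.flip y).domRestrict (A.pow 3) u ∈ A.pow 5 :=
    fun y hy u => h.mul_pow_three_upper_four u.2 hy
  have hker : ∀ y (hy : y ∈ A.upper 4), (A.pow 4).submoduleOf (A.pow 3) ≤
      LinearMap.ker (((A.mul.flip y).domRestrict (A.pow 3)).codRestrict (A.pow 5) (hmap y hy)) := by
    intro y hy u hu
    refine LinearMap.mem_ker.2 (Subtype.ext ?_)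
    have hu' : (u : L) ∈ A.pow 4 := hu
    refine A.form_nondegenerate _ fun v => ?_
    change A.form (A.mul u y) v = 0
    rw [A.form_mul_swap_right, form_eq_neg (A.form_upper_pow hy (A.mul_mem_pow_succ hu' v))]
    simp
  have hy₂4 := h.pow_two_le_upper_four hy₂
  let φ := ((A.pow 4).submoduleOf (A.pow 3)).liftQ _ (hker y₂ hy₂4)
  let ψ := ((A.pow 4).submoduleOf (A.pow 3)).liftQ _ (hker y₃ hy₃)
  have hsurj : Function.Surjective φ := by
    rintro ⟨v, hv⟩
    rw [← h.map_mul_pow_three hy₂ hy₂'] at hv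
    obtain ⟨u, hu, rfl⟩ := hv
    exact ⟨Submodule.Quotient.mk ⟨u, hu⟩, Subtype.ext rfl⟩
  have hfin : finrank F (A.pow 3 ⧸ (A.pow 4).submoduleOf (A.pow 3)) = finrank F (A.pow 5) := by
    have h1 := finrank_quotient_add_finrank ((A.pow 4).submoduleOf (A.pow 3))
    have h2 : finrank F ((A.pow 4).submoduleOf (A.pow 3)) = finrank F (A.pow 4) :=
      (submoduleOfEquivOfLe (A.pow_succ_le 3)).finrank_eq
    rw [h2, h.pow_four_eq, h.finrank_upper_two, h.finrank_pow_three, ← h.pow_four_eq] at h1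
    rw [h.finrank_pow_five]
    omega
  have hinj := (LinearMap.injective_iff_surjective_of_finrank_eq_finrank hfin).2 hsurj
  let φ' := LinearEquiv.ofBijective φ ⟨hinj, hsurj⟩
  refine ⟨ψ ∘ₗ φ'.symm.toLinearMap, ⟨φ', ψ, fun u => rfl, fun u => rfl, rfl⟩, ?_⟩
  intro u hu v w hv hw
  have e : φ' (Submodule.Quotient.mk ⟨u, hu⟩) = v := Subtype.ext hv.symm
  rw [← e]
  simp only [LinearMap.comp_apply, LinearEquiv.coe_coe, LinearEquiv.symm_apply_apply]
  exact Subtype.ext hw.symm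

/-- After a shift of `y₃` by a multiple of `y₂`, the square of `τ` is a non-square scalar. -/
theorem exists_mul_mul_eq (h2 : (2 : F) ≠ 0) {y₂ y₃ : L} (hy₂ : y₂ ∈ A.pow 2)
    (hy₂' : y₂ ∉ A.pow 3) (hy₃ : y₃ ∈ A.upper 4) (hy₃' : y₃ ∉ A.pow 2)
    (hC : ∀ τ : Module.End F (A.pow 5), A.IsTau y₂ y₃ τ → Irreducible (minpoly F τ)) :
    ∃ y ∈ A.upper 4, y ∉ A.pow 2 ∧ ∃ s : F, ¬ IsSquare s ∧ ∀ u ∈ A.pow 3, ∀ v ∈ A.pow 3,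
      A.mul v y₂ = A.mul u y → A.mul v y = s • A.mul u y₂ := by
  obtain ⟨τ, hτ, hval⟩ := h.exists_tau hy₂ hy₂' hy₃
  have hy₂4 := h.pow_two_le_upper_four hy₂
  -- If $\tau=c$, then $y_3-cy_2$ annihilates $L^3$, hence lies in $L^2$, and so does $y_3$.
  have hns : ∀ c : F, ∃ v, τ v ≠ c • v := by
    intro c
    by_contra! hc
    have : y₃ - c • y₂ ∈ A.pow 2 := h.mem_pow_two_of_mul_pow_three fun u hu => by
      have e := hval u hu ⟨_, h.mul_pow_three_upper_four hu hy₂4⟩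
        ⟨_, h.mul_pow_three_upper_four hu hy₃⟩ rfl rfl
      rw [hc] at e
      have e' := congrArg Subtype.val e
      rw [map_sub, map_smul, sub_eq_zero]
      exact e'.symm
    exact hy₃' (by simpa using add_mem this (smul_mem _ c hy₂))
  obtain ⟨t, s, hs, hts⟩ := exists_sq_eq_of_irreducible_minpoly h2 h.finrank_pow_five τ (hC τ hτ) hns
  refine ⟨y₃ - t • y₂, sub_mem hy₃ (smul_mem _ _ hy₂4), fun hy => hy₃' ?_, s, hs, ?_⟩
  · simpa using add_mem hy (smul_mem _ t hy₂)
  intro u hu v hv huv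
  have eu := hval u hu ⟨_, h.mul_pow_three_upper_four hu hy₂4⟩
    ⟨_, h.mul_pow_three_upper_four hu hy₃⟩ rfl rfl
  have ev := hval v hv ⟨_, h.mul_pow_three_upper_four hv hy₂4⟩
    ⟨_, h.mul_pow_three_upper_four hv hy₃⟩ rfl rfl
  have e := hts ⟨_, h.mul_pow_three_upper_four hu hy₂4⟩
  rw [eu] at e
  have e1 : (⟨A.mul u y₃, h.mul_pow_three_upper_four hu hy₃⟩ : A.pow 5) -
      t • ⟨A.mul u y₂, h.mul_pow_three_upper_four hu hy₂4⟩ =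
      ⟨A.mul v y₂, h.mul_pow_three_upper_four hv hy₂4⟩ := Subtype.ext (by
    rw [map_sub, map_smul] at huv; exact huv.symm)
  rw [e1, ev] at e
  rw [map_sub, map_smul]
  exact congrArg Subtype.val e

/-- This is the injectivity of $\phi$: $u$ annihilates $L^3+\mathbb Fy_2=L^2$, so $(uv,w)=-(uw,v)=0$
for $w\in L^2$ and $uv\in(L^2)^\perp=Z_1$. -/
theorem mem_upper_two_of_mul_eq_zero {y₂ u : L} (hy₂ : y₂ ∈ A.pow 2) (hy₂' : y₂ ∉ A.pow 3)
    (hu : u ∈ A.pow 3) (huy : A.mul u y₂ = 0) : u ∈ A.upper 2 := by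
  have := h.finiteDimensional
  intro v
  rw [A.upper_eq_perp 1]
  refine mem_perp'.2 fun w hw => ?_
  change w ∈ A.pow 2 at hw
  rw [← sup_span_singleton_eq (A.pow_succ_le 2) hy₂ hy₂'
    (by rw [h.finrank_pow_two, h.finrank_pow_three])] at hw
  obtain ⟨a, ha, b, hb, rfl⟩ := mem_sup.1 hw
  obtain ⟨c, rfl⟩ := mem_span_singleton.1 hb
  rw [A.form_mul_swap_right, map_add, map_smul, h.mul_pow_three hu ha, huy]
  simp

/-- Elements `x₁, y₁` of `L^3` and `y₂`, `y₃` in which `τ` has its rational canonical form. -/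
theorem exists_rational_form (h2 : (2 : F) ≠ 0) (hC : A.IsTypeC) :
    ∃ x₁ ∈ A.pow 3, ∃ y₁ ∈ A.pow 3, ∃ y₂ ∈ A.pow 2, y₂ ∉ A.pow 3 ∧ ∃ y₃ ∈ A.upper 4,
      y₃ ∉ A.pow 2 ∧ ∃ s : F, ¬ IsSquare s ∧ A.form x₁ y₁ = 1 ∧ A.mul x₁ y₂ = A.mul y₁ y₃ ∧
      A.mul x₁ y₃ = s • A.mul y₁ y₂ ∧ LinearIndependent F ![A.mul x₁ y₂, A.mul y₁ y₂] := by
  have := h.finiteDimensional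
  obtain ⟨y₂, hy₂, hy₂', y₃, hy₃, hy₃', hirr⟩ := hC
  obtain ⟨y, hy, hy', s, hs, hsq⟩ := h.exists_mul_mul_eq h2 hy₂ hy₂' hy₃ hy₃' hirr
  have hsur : ∀ v ∈ A.pow 5, ∃ u ∈ A.pow 3, A.mul u y₂ = v := by
    intro v hv
    rw [← h.map_mul_pow_three hy₂ hy₂'] at hv
    exact hv
  obtain ⟨y₁, hy₁, hy₁0⟩ : ∃ u ∈ A.pow 3, A.mul u y₂ ≠ 0 := by
    by_contra! hc
    have := finrank_mono (show A.pow 5 ≤ ⊥ from fun v hv => by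
      obtain ⟨u, hu, rfl⟩ := hsur v hv
      exact (mem_bot F).2 (hc u hu))
    rw [h.finrank_pow_five, finrank_bot] at this
    omega
  obtain ⟨x₁, hx₁, hxy⟩ := hsur _ (h.mul_pow_three_upper_four hy₁ hy)
  have hxs := hsq y₁ hy₁ x₁ hx₁ hxy
  -- A dependence would make $y_1y_2$ an eigenvector with some eigenvalue $c$, and then $c^2=s$.
  have hli : LinearIndependent F ![A.mul x₁ y₂, A.mul y₁ y₂] := by
    refine LinearIndependent.pair_iff.2 fun a b hab => ?_
    by_cases ha : a = 0
    · subst ha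
      rw [zero_smul, zero_add, smul_eq_zero] at hab
      exact ⟨rfl, hab.resolve_right hy₁0⟩
    · exfalso
      have e : A.mul x₁ y₂ = (-(b / a)) • A.mul y₁ y₂ := by
        have : a • (A.mul x₁ y₂ + (b / a) • A.mul y₁ y₂) = 0 := by
          rw [smul_add, smul_smul, mul_div_cancel₀ _ ha, hab]
        rw [neg_smul]
        exact eq_neg_of_add_eq_zero_left ((smul_eq_zero.1 this).resolve_left ha)
      set c := -(b / a)
      have hk : A.mul (x₁ - c • y₁) y₂ = 0 := by
        rw [map_sub, map_smul, LinearMap.sub_apply, LinearMap.smul_apply, e, sub_self]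
      have hk2 := h.mem_upper_two_of_mul_eq_zero hy₂ hy₂'
        (sub_mem hx₁ (smul_mem _ c hy₁)) hk
      have hk3 : A.mul (x₁ - c • y₁) y = 0 := by
        refine A.form_nondegenerate _ fun v => ?_
        rw [A.form_mul_swap_right, form_eq_neg (A.form_upper_pow hy
          (A.mul_mem_pow_succ (h.upper_two_le_pow_four hk2) v))]
        simp
      rw [map_sub, map_smul, LinearMap.sub_apply, LinearMap.smul_apply, hxs, ← hxy, e, smul_smul,
        ← sub_smul, smul_eq_zero, sub_eq_zero] at hk3
      exact hs ⟨c, hk3.resolve_right hy₁0⟩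
  -- $L^3=Z_2+\mathbb Fx_1+\mathbb Fy_1$; if $(x_1,y_1)=0$, then $y_1\in(L^3)^\perp=Z_2$ and
  -- $y_1y_2=0$.
  have hne : A.form x₁ y₁ ≠ 0 := by
    intro h0
    refine hy₁0 (A.mul_upper_pow (k := 2) ?_ hy₂)
    rw [A.upper_eq_perp 2]
    refine mem_perp.2 fun u hu => ?_
    have hsp : span F (Set.range ![A.mul x₁ y₂, A.mul y₁ y₂]) = A.pow 5 := by
      refine eq_of_le_of_finrank_le ?_ ?_
      · rw [span_le]
        rintro _ ⟨i, rfl⟩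
        fin_cases i
        · exact h.mul_pow_three_upper_four hx₁ (h.pow_two_le_upper_four hy₂)
        · exact h.mul_pow_three_upper_four hy₁ (h.pow_two_le_upper_four hy₂)
      · rw [finrank_span_eq_card hli, Fintype.card_fin, h.finrank_pow_five]
    have huy := h.mul_pow_three_upper_four hu (h.pow_two_le_upper_four hy₂)
    rw [← hsp, Matrix.range_cons, Matrix.range_cons, Matrix.range_empty, Set.union_empty,
      Set.singleton_union, mem_span_pair] at huy
    obtain ⟨a, b, hab⟩ := huy
    have hk : A.mul (u - a • x₁ - b • y₁) y₂ = 0 := by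
      simp only [map_sub, map_smul, LinearMap.sub_apply, LinearMap.smul_apply]
      rw [← hab]; abel
    have hk2 := h.mem_upper_two_of_mul_eq_zero hy₂ hy₂'
      (sub_mem (sub_mem hu (smul_mem _ a hx₁)) (smul_mem _ b hy₁)) hk
    have hk3 := A.form_upper_pow hk2 hy₁
    simpa [h0, A.form_self] using hk3
  set l := A.form x₁ y₁
  have hl : l⁻¹ ≠ 0 := inv_ne_zero hne
  -- Scaling $x_1$ and $y_3$ by the same $l^{-1}$ keeps $x_1y_2=y_1y_3$, and changes $s$ by the
  -- square $l^{-2}$.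
  refine ⟨l⁻¹ • x₁, smul_mem _ _ hx₁, y₁, hy₁, y₂, hy₂, hy₂', l⁻¹ • y, smul_mem _ _ hy,
    fun hy2 => hy' ((smul_mem_iff _ hl).1 hy2), l⁻¹ * l⁻¹ * s, ?_, ?_, ?_, ?_, ?_⟩
  · rintro ⟨a, ha⟩
    refine hs ⟨l * a, ?_⟩
    rw [mul_mul_mul_comm, ← ha]
    field_simp
  · rw [map_smul, LinearMap.smul_apply, smul_eq_mul]
    exact inv_mul_cancel₀ hne
  · rw [map_smul, map_smul, LinearMap.smul_apply, hxy]
  · rw [map_smul, map_smul, LinearMap.smul_apply, hxs, smul_smul, smul_smul]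
  · rw [map_smul, LinearMap.smul_apply]
    refine LinearIndependent.pair_iff.2 fun a b hab => ?_
    rw [smul_smul] at hab
    obtain ⟨h1, h3⟩ := LinearIndependent.pair_iff.1 hli _ _ hab
    exact ⟨(mul_eq_zero.1 h1).resolve_right hl, h3⟩

end IsClass38

end NormalForm
end SympAltAlg

namespace SympAltAlg

/-! ### Removal of the remaining structure constants -/

section TypeC

open Module Submodule

variable {F : Type*} [Field F] {L : Type*} [AddCommGroup L] [Module F L]

theorem exists_form_eq_one_zero (A : SympAltAlg F L) [FiniteDimensional F L] {p q : L}
    (hpq : LinearIndependent F ![p, q]) : ∃ y, A.form p y = 1 ∧ A.form q y = 0 := by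
  obtain ⟨y, hqy, hpy⟩ : ∃ y, A.form q y = 0 ∧ A.form p y ≠ 0 := by
    by_contra! hc
    have h1 : A.perp (F ∙ q) ≤ A.perp (F ∙ p) := fun y hy => mem_perp.2 fun u hu => by
      obtain ⟨c, rfl⟩ := mem_span_singleton.1 hu
      rw [map_smul, LinearMap.smul_apply, hc y (mem_perp.1 hy q (mem_span_singleton_self q)),
        smul_zero]
    have h2 := A.perp_anti h1
    rw [perp_perp, perp_perp] at h2
    obtain ⟨c, hc⟩ := mem_span_singleton.1 (h2 (mem_span_singleton_self p))
    have := (LinearIndependent.pair_iff.1 hpq 1 (-c) (by rw [hc.symm]; simp)).1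
    exact one_ne_zero this
  exact ⟨(A.form p y)⁻¹ • y, by rw [map_smul, smul_eq_mul, inv_mul_cancel₀ hpy],
    by rw [map_smul, hqy, smul_zero]⟩

/-- Bundled as `simp` input: one value of the alternating triple form fixes its five reorderings. -/
theorem form_mul_perms {A : SympAltAlg F L} {a b c : L} {k : F} (h : A.form (A.mul a b) c = k) :
    A.form (A.mul b a) c = -k ∧ A.form (A.mul a c) b = -k ∧ A.form (A.mul c b) a = -k ∧
      A.form (A.mul b c) a = k ∧ A.form (A.mul c a) b = k := by
  have h1 : A.form (A.mul b c) a = k := by rw [← A.form_mul, h]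
  have h2 : A.form (A.mul c a) b = k := by rw [A.form_mul, h]
  exact ⟨by rw [A.form_mul_swap, h], by rw [A.form_mul_swap_right, h],
    by rw [A.form_mul_swap, h1], h1, h2⟩

theorem form_mul_eq_zero_of_mul_eq_zero {A : SympAltAlg F L} {a b : L} (h : A.mul a b = 0) :
    (∀ v, A.form (A.mul a b) v = 0) ∧ (∀ v, A.form (A.mul b a) v = 0) ∧
      (∀ v, A.form (A.mul a v) b = 0) ∧ (∀ v, A.form (A.mul b v) a = 0) ∧
      (∀ v, A.form (A.mul v a) b = 0) ∧ ∀ v, A.form (A.mul v b) a = 0 := by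
  have h0 : ∀ v, A.form (A.mul a b) v = 0 := by simp [h]
  have hp := fun v => form_mul_perms (h0 v)
  simp only [neg_zero] at hp
  exact ⟨h0, fun v => (hp v).1, fun v => (hp v).2.1, fun v => (hp v).2.2.2.1,
    fun v => (hp v).2.2.2.2, fun v => (hp v).2.2.1⟩

/-- The elements `y₃, y₄, y₅` can be changed by elements of `L^2` so that the remaining structure
constants vanish. -/
theorem exists_reduced (A : SympAltAlg F L) {U : Submodule F L} {x₁ x₂ y₁ y₂ y₃ y₄ y₅ : L}
    {s : F} (hx₁ : x₁ ∈ U) (hx₂ : x₂ ∈ U) (hy₁ : y₁ ∈ U) (hy₂ : y₂ ∈ U)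
    (m1 : A.mul x₁ x₂ = 0) (m2 : A.mul x₁ y₁ = 0) (m3 : A.mul x₂ y₁ = 0) (m4 : A.mul x₂ y₂ = 0)
    (m5 : A.mul x₂ y₃ = 0) (p12x : A.form (A.mul x₁ y₂) y₃ = 0)
    (p12y : A.form (A.mul y₁ y₂) y₃ = 0) (h1 : A.mul x₁ y₂ = A.mul y₁ y₃)
    (h3 : A.mul x₁ y₃ = s • A.mul y₁ y₂) (h44 : A.form (A.mul x₁ y₂) y₄ = 1)
    (h45 : A.form (A.mul x₁ y₂) y₅ = 0) (h54 : A.form (A.mul y₁ y₂) y₄ = 0)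
    (h55 : A.form (A.mul y₁ y₂) y₅ = 1) (hr : A.form (A.mul x₂ y₄) y₅ ≠ 0) :
    ∃ Y₃ Y₄ Y₅ : L, Y₃ - y₃ ∈ U ∧ Y₄ - y₄ ∈ U ∧ Y₅ - y₅ ∈ U ∧
      A.mul x₂ Y₃ = 0 ∧ A.form (A.mul x₁ y₂) Y₃ = 0 ∧ A.form (A.mul y₁ y₂) Y₃ = 0 ∧
      A.form (A.mul x₁ y₂) Y₄ = 1 ∧ A.form (A.mul x₁ y₂) Y₅ = 0 ∧
      A.form (A.mul y₁ y₂) Y₄ = 0 ∧ A.form (A.mul y₁ y₂) Y₅ = 1 ∧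
      A.form (A.mul x₁ Y₃) Y₄ = 0 ∧ A.form (A.mul x₁ Y₃) Y₅ = s ∧
      A.form (A.mul y₁ Y₃) Y₄ = 1 ∧ A.form (A.mul y₁ Y₃) Y₅ = 0 ∧
      A.form (A.mul x₁ Y₄) Y₅ = 0 ∧ A.form (A.mul y₁ Y₄) Y₅ = 0 ∧
      A.form (A.mul x₂ Y₄) Y₅ = A.form (A.mul x₂ y₄) y₅ ∧
      A.form (A.mul y₂ Y₃) Y₄ = 0 ∧ A.form (A.mul y₂ Y₃) Y₅ = 0 ∧
      A.form (A.mul y₂ Y₄) Y₅ = 0 ∧ A.form (A.mul Y₃ Y₄) Y₅ = 0 := by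
  have k34 : A.form (A.mul x₁ y₃) y₄ = 0 := by simp [h3, h54]
  have k35 : A.form (A.mul x₁ y₃) y₅ = s := by simp [h3, h55]
  have l34 : A.form (A.mul y₁ y₃) y₄ = 1 := by rw [← h1, h44]
  have l35 : A.form (A.mul y₁ y₃) y₅ = 0 := by rw [← h1, h45]
  obtain ⟨Y₄, Y₅, hY₄, hY₅, Q24, Q25, Q24', Q25', Q34, Q35, Q34', Q35', Q45, Q45', R45, S45⟩ :
      ∃ Y₄ Y₅ : L, Y₄ - y₄ ∈ U ∧ Y₅ - y₅ ∈ U ∧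
      A.form (A.mul x₁ y₂) Y₄ = 1 ∧ A.form (A.mul x₁ y₂) Y₅ = 0 ∧
      A.form (A.mul y₁ y₂) Y₄ = 0 ∧ A.form (A.mul y₁ y₂) Y₅ = 1 ∧
      A.form (A.mul x₁ y₃) Y₄ = 0 ∧ A.form (A.mul x₁ y₃) Y₅ = s ∧
      A.form (A.mul y₁ y₃) Y₄ = 1 ∧ A.form (A.mul y₁ y₃) Y₅ = 0 ∧
      A.form (A.mul x₁ Y₄) Y₅ = 0 ∧ A.form (A.mul y₁ Y₄) Y₅ = 0 ∧
      A.form (A.mul x₂ Y₄) Y₅ = A.form (A.mul x₂ y₄) y₅ ∧ A.form (A.mul y₂ Y₄) Y₅ = 0 := by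
    -- By $(y_1y_2,y_5)=1=(x_1y_2,y_4)$, the $y_2$-shift of $y_4$ kills $(y_1y_4,y_5)$, its
    -- $y_1$-shift kills $(y_2y_4,y_5)$, and the $y_2$-shift of $y_5$ kills $(x_1y_4,y_5)$.
    refine ⟨y₄ - A.form (A.mul y₁ y₄) y₅ • y₂ + A.form (A.mul y₂ y₄) y₅ • y₁,
      y₅ + A.form (A.mul x₁ y₄) y₅ • y₂, ?_, ?_, ?_⟩
    · have : ∀ a b c : L, a - b + c - a = -b + c := fun a b c => by abel
      rw [this]
      exact add_mem (neg_mem (smul_mem _ _ hy₂)) (smul_mem _ _ hy₁)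
    · rw [add_sub_cancel_left]; exact smul_mem _ _ hy₂
    · simp [form_mul_self_right, form_mul_self_outer, form_mul_self_left,
        form_mul_eq_zero_of_mul_eq_zero m2, form_mul_eq_zero_of_mul_eq_zero m3,
        form_mul_eq_zero_of_mul_eq_zero m4, h44, h45, h54, h55, k34, k35, l34, l35,
        form_mul_perms p12x, form_mul_perms p12y, form_mul_perms h44, form_mul_perms h54, form_mul_perms h55]
  -- The $x_1$- and $y_1$-shifts kill $(y_2y_3,Y_4)$ and $(y_2y_3,Y_5)$; the $x_2$-shift kills
  -- $(y_3Y_4,Y_5)$, dividing by $r\ne0$.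
  refine ⟨y₃ + A.form (A.mul y₂ y₃) Y₄ • x₁ + A.form (A.mul y₂ y₃) Y₅ • y₁ -
    (A.form (A.mul y₃ Y₄) Y₅ / A.form (A.mul x₂ Y₄) Y₅) • x₂, Y₄, Y₅, ?_, hY₄, hY₅, ?_, ?_, ?_,
    Q24, Q25, Q24', Q25', ?_, ?_, ?_, ?_, Q45, Q45', R45, ?_, ?_, S45, ?_⟩
  · have : ∀ a b c d : L, a + b + c - d - a = b + c - d := fun a b c d => by abel
    rw [this]
    exact sub_mem (add_mem (smul_mem _ _ hx₁) (smul_mem _ _ hy₁)) (smul_mem _ _ hx₂)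
  · simp [m5, mul_eq_zero_symm m1, m3, A.mul_self]
  all_goals
    simp [form_mul_self_outer, form_mul_self_left, form_mul_eq_zero_of_mul_eq_zero m1, form_mul_eq_zero_of_mul_eq_zero m2,
      form_mul_eq_zero_of_mul_eq_zero m3, form_mul_eq_zero_of_mul_eq_zero m4, p12x, p12y,
      Q34, Q35, Q34', Q35', Q45, Q45', form_mul_perms Q24,
      form_mul_perms Q25, form_mul_perms Q24', form_mul_perms Q25', R45, hr]

namespace IsClass38

variable {A : SympAltAlg F L} (h : A.IsClass38)
include h

/-- A symplectic basis of `L^2` modulo the centre, together with `y₃, y₄, y₅`, in which the leading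
structure constants have their normal form. -/
theorem exists_leading_form (h2 : (2 : F) ≠ 0) (hC : A.IsTypeC) :
    ∃ x₁ ∈ A.pow 3, ∃ y₁ ∈ A.pow 3, ∃ x₂ ∈ A.upper 2, ∃ y₂ ∈ A.pow 2, ∃ y₃ ∈ A.upper 4,
      ∃ y₄ y₅ : L, ∃ s : F, y₃ ∉ A.pow 2 ∧ ¬ IsSquare s ∧ A.form x₁ y₁ = 1 ∧ A.form x₁ y₂ = 0 ∧
      A.form y₁ y₂ = 0 ∧ A.form x₂ y₂ = 1 ∧ A.mul x₁ y₂ = A.mul y₁ y₃ ∧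
      A.mul x₁ y₃ = s • A.mul y₁ y₂ ∧ A.form (A.mul x₁ y₂) y₄ = 1 ∧ A.form (A.mul x₁ y₂) y₅ = 0 ∧
      A.form (A.mul y₁ y₂) y₄ = 0 ∧ A.form (A.mul y₁ y₂) y₅ = 1 ∧
      ∀ v, ∃ u ∈ A.upper 4, ∃ b c : F, v = u + b • y₄ + c • y₅ := by
  have := h.finiteDimensional
  obtain ⟨x₁, hx₁, y₁, hy₁, y₂, hy₂, hy₂', y₃, hy₃, hy₃', s, hs, hxy, h1, h3, hli⟩ :=
    h.exists_rational_form h2 hC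
  obtain ⟨x₂, hx₂, hx₂y⟩ : ∃ x ∈ A.upper 2, A.form x y₂ = 1 := by
    obtain ⟨x, hx, hxy⟩ : ∃ x ∈ A.upper 2, A.form x y₂ ≠ 0 := by
      by_contra! hc
      exact hy₂' (by rw [← A.perp_upper 2]; exact mem_perp.2 hc)
    exact ⟨(A.form x y₂)⁻¹ • x, smul_mem _ _ hx, by
      rw [map_smul, LinearMap.smul_apply, smul_eq_mul, inv_mul_cancel₀ hxy]⟩
  have hyx := form_eq_neg hxy
  obtain ⟨y₄, h44, h45⟩ := A.exists_form_eq_one_zero hli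
  obtain ⟨y₅, h55, h54⟩ := A.exists_form_eq_one_zero
    (LinearIndependent.pair_symm_iff.1 hli)
  -- Since $L^3L^3=0$, $y_2$ can be made orthogonal to $x_1,y_1$ by elements of $L^3$ without
  -- changing its products with $L^3$.
  have e1 : ∀ u ∈ A.pow 3, A.mul u (y₂ + A.form y₁ y₂ • x₁ - A.form x₁ y₂ • y₁) = A.mul u y₂ :=
    fun u hu => by
      rw [map_sub, map_add, map_smul, map_smul, h.mul_pow_three hu hx₁, h.mul_pow_three hu hy₁]
      simp
  refine ⟨x₁, hx₁, y₁, hy₁, x₂, hx₂, y₂ + A.form y₁ y₂ • x₁ - A.form x₁ y₂ • y₁,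
    sub_mem (add_mem hy₂ (smul_mem _ _ (A.pow_succ_le 2 hx₁)))
      (smul_mem _ _ (A.pow_succ_le 2 hy₁)), y₃, hy₃, y₄, y₅, s, hy₃', hs, hxy, ?_, ?_, ?_, ?_, ?_,
      ?_, ?_, ?_, ?_, fun v => ?_⟩
  · simp [A.form_self, hxy]
  · simp [A.form_self, hyx]
  · simp [hx₂y, A.form_upper_pow hx₂ hx₁, A.form_upper_pow hx₂ hy₁]
  · rw [e1 x₁ hx₁, h1]
  · rw [e1 y₁ hy₁, h3]
  · rw [e1 x₁ hx₁, h44]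
  · rw [e1 x₁ hx₁, h54]
  · rw [e1 y₁ hy₁, h45]
  · rw [e1 y₁ hy₁, h55]
  · have hy₂4 := h.pow_two_le_upper_four hy₂
    refine ⟨v - A.form (A.mul x₁ y₂) v • y₄ - A.form (A.mul y₁ y₂) v • y₅, ?_,
      A.form (A.mul x₁ y₂) v, A.form (A.mul y₁ y₂) v, by abel⟩
    have hsp : A.pow 5 ≤ span F (Set.range ![A.mul x₁ y₂, A.mul y₁ y₂]) := by
      refine (eq_of_le_of_finrank_le ?_ ?_).ge
      · rw [span_le]
        rintro _ ⟨i, rfl⟩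
        fin_cases i
        · exact h.mul_pow_three_upper_four hx₁ hy₂4
        · exact h.mul_pow_three_upper_four hy₁ hy₂4
      · rw [finrank_span_eq_card hli, Fintype.card_fin, h.finrank_pow_five]
    rw [A.upper_eq_perp 4]
    refine mem_perp.2 fun u hu => ?_
    have hu' := hsp hu
    rw [Matrix.range_cons, Matrix.range_cons, Matrix.range_empty, Set.union_empty,
      Set.singleton_union, mem_span_pair] at hu'
    obtain ⟨a, b, rfl⟩ := hu'
    simp [h44, h45, h54, h55]

theorem hasPresentation_of_isTypeC (h2 : (2 : F) ≠ 0) (hC : A.IsTypeC) :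
    ∃ r s : F, r ≠ 0 ∧ ¬ IsSquare s ∧ A.HasPresentation (NilpPres.P38 r s) := by
  have := h.finiteDimensional
  obtain ⟨x₁, hx₁, y₁, hy₁, x₂, hx₂, y₂, hy₂, y₃, hy₃, y₄, y₅, s, hy₃', hs, f11, f12, g12, f22,
    h1, h3, h44, h45, h54, h55, hdec⟩ := h.exists_leading_form h2 hC
  have hx₂3 := h.upper_two_le_pow_three hx₂
  have hy₂4 := h.pow_two_le_upper_four hy₂
  have m1 := h.mul_pow_three hx₁ hx₂3
  have m2 := h.mul_pow_three hx₁ hy₁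
  have m3 := h.mul_pow_three hx₂3 hy₁
  have m4 := A.mul_upper_pow hx₂ hy₂
  have m5 : A.mul x₂ y₃ = 0 := A.form_nondegenerate _ fun v => by
    rw [A.form_mul_swap_right, form_eq_neg (A.form_upper_pow hy₃
      (A.mul_mem_pow_succ (h.upper_two_le_pow_four hx₂) v))]
    simp
  have p12 : ∀ u ∈ A.pow 3, A.form (A.mul u y₂) y₃ = 0 := fun u hu => by
    rw [form_eq_neg (A.form_upper_pow hy₃ (h.mul_pow_three_upper_four hu hy₂4)), neg_zero]
  have p12x := p12 x₁ hx₁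
  have p12y := p12 y₁ hy₁
  have hdec' : ∀ v, ∃ u ∈ A.pow 2, ∃ a b c : F, v = u + a • y₃ + b • y₄ + c • y₅ := by
    intro v
    obtain ⟨u, hu, b, c, rfl⟩ := hdec v
    rw [← sup_span_singleton_eq h.pow_two_le_upper_four hy₃ hy₃'
      (by rw [h.finrank_upper_four, h.finrank_pow_two])] at hu
    obtain ⟨u', hu', t, ht, rfl⟩ := mem_sup.1 hu
    obtain ⟨a, rfl⟩ := mem_span_singleton.1 ht
    exact ⟨u', hu', a, b, c, rfl⟩
  -- $x_2$ annihilates $L^2$ and $y_3$, so $r=0$ would make it central, hence orthogonal to $y_2\in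
  -- L^2$.
  have hr : A.form (A.mul x₂ y₄) y₅ ≠ 0 := by
    intro hr
    have hx0 : x₂ ∈ A.upper 1 := A.mem_upper_one.2 fun v => A.form_nondegenerate _ fun w => by
      obtain ⟨u, hu, a, b, c, rfl⟩ := hdec' v
      obtain ⟨u', hu', a', b', c', rfl⟩ := hdec' w
      have e1 := A.mul_upper_pow hx₂ hu
      have e2 := A.mul_upper_pow hx₂ hu'
      have e3 : ∀ t, A.form (A.mul x₂ t) u' = 0 := fun t => by
        rw [A.form_mul_swap_right, e2]; simp
      have e4 : ∀ t, A.form (A.mul x₂ t) y₃ = 0 := fun t => by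
        rw [A.form_mul_swap_right, m5]; simp
      have e5 : A.form (A.mul x₂ y₅) y₄ = 0 := by
        rw [A.form_mul_swap_right, hr, neg_zero]
      simp [e1, m5, e3, e4, hr, e5, A.form_mul_self_right]
    rw [A.form_upper_pow hx0 hy₂] at f22
    exact zero_ne_one f22
  set r := A.form (A.mul x₂ y₄) y₅ with hrdef
  have hx₁2 := A.pow_succ_le 2 hx₁
  have hy₁2 := A.pow_succ_le 2 hy₁
  obtain ⟨Y₃, Y₄, Y₅, hY₃, hY₄, hY₅, M5, P12x, P12y, Q24, Q25, Q24', Q25', Q34, Q35, Q34', Q35',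
      Q45, Q45', R45, S34, S35, S45, T⟩ := A.exists_reduced hx₁2 (A.pow_succ_le 2 hx₂3) hy₁2 hy₂
    m1 m2 m3 m4 m5 p12x p12y h1 h3 h44 h45 h54 h55 hr
  have hdecY : ∀ v, ∃ u ∈ A.pow 2, ∃ a b c : F, v = u + a • Y₃ + b • Y₄ + c • Y₅ := fun v => by
    obtain ⟨u, hu, a, b, c, rfl⟩ := hdec' v
    refine ⟨u - a • (Y₃ - y₃) - b • (Y₄ - y₄) - c • (Y₅ - y₅), sub_mem (sub_mem (sub_mem hu
      (smul_mem _ a hY₃)) (smul_mem _ b hY₄)) (smul_mem _ c hY₅), a, b, c, by module⟩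
  -- The centre is orthogonal to $L^2$, and $L^2$ with $Y_3,Y_4,Y_5$ spans $L$, so pairing with
  -- these three identifies the centre with $\mathbb F^3$.
  obtain ⟨z, hz, hzw⟩ : ∃ z : Fin 3 → L, (∀ i, z i ∈ A.upper 1) ∧
      ∀ i j, A.form (z i) (![Y₃, Y₄, Y₅] j) = if i = j then 1 else 0 := by
    let T : A.upper 1 →ₗ[F] (Fin 3 → F) :=
      LinearMap.pi fun j => A.form.flip (![Y₃, Y₄, Y₅] j) ∘ₗ (A.upper 1).subtype
    have hinj : Function.Injective T := by
      refine (injective_iff_map_eq_zero T).2 fun t ht => Subtype.ext ?_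
      have ht' : ∀ j, A.form t (![Y₃, Y₄, Y₅] j) = 0 := fun j => congrFun ht j
      have e1 : A.form t Y₃ = 0 := ht' 0
      have e2 : A.form t Y₄ = 0 := ht' 1
      have e3 : A.form t Y₅ = 0 := ht' 2
      refine A.form_nondegenerate _ fun v => ?_
      obtain ⟨u, hu, a, b, c, rfl⟩ := hdecY v
      simp [e1, e2, e3, A.form_upper_pow t.2 hu]
    have hsurj : Function.Surjective T :=
      (LinearMap.injective_iff_surjective_of_finrank_eq_finrank
        (by rw [h.finrank_upper_one, finrank_fin_fun])).1 hinj
    choose g hg using hsurj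
    refine ⟨fun i => g (Pi.single i 1), fun i => (g _).2, fun i j => ?_⟩
    have := congrFun (hg (Pi.single i 1)) j
    rw [Pi.single_apply] at this
    exact this.trans (by simp [eq_comm])
  obtain ⟨x, y, hxx, hyy, hxy, c0, c1, c2, c3, c4, d0, d1, d2, d3, d4⟩ :=
    A.exists_standard_of_mod_center h2 h.isotropic (A.pow_succ_le 2 hx₁)
      (h.upper_two_le_pow_two hx₂) (A.pow_succ_le 2 hy₁) hy₂
      (by rw [A.form_skew, A.form_upper_pow hx₂ hx₁, neg_zero]) g12 f11 f12
      (A.form_upper_pow hx₂ hy₁) f22 hz hzw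
  refine ⟨r, s, hr, hs, A.hasPresentation_P38 h.finrank_eq hxx hyy hxy c2 c3 c4
    ?_ ?_ ?_ ?_ ?_ ?_ ?_ ?_ ?_ ?_ ?_ ?_ ?_ ?_ ?_ ?_ ?_ ?_ ?_ ?_ ?_ ?_⟩
  · rwa [A.mul_eq_of_sub_mem_center c0 c1]
  · rwa [A.mul_eq_of_sub_mem_center c0 d0]
  · rwa [A.mul_eq_of_sub_mem_center c1 d0]
  · rwa [A.mul_eq_of_sub_mem_center c1 d1]
  · exact (A.mul_eq_of_sub_mem_center c1 d2).trans M5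
  · exact (A.form_mul_eq_of_sub_mem_center c1 d3 d4).trans R45
  · exact (A.form_mul_eq_of_sub_mem_center c0 d1 d2).trans P12x
  · exact (A.form_mul_eq_of_sub_mem_center c0 d1 d3).trans Q24
  · exact (A.form_mul_eq_of_sub_mem_center c0 d1 d4).trans Q25
  · exact (A.form_mul_eq_of_sub_mem_center c0 d2 d3).trans Q34
  · exact (A.form_mul_eq_of_sub_mem_center c0 d2 d4).trans Q35
  · exact (A.form_mul_eq_of_sub_mem_center c0 d3 d4).trans Q45
  · exact (A.form_mul_eq_of_sub_mem_center d0 d1 d2).trans P12y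
  · exact (A.form_mul_eq_of_sub_mem_center d0 d1 d3).trans Q24'
  · exact (A.form_mul_eq_of_sub_mem_center d0 d1 d4).trans Q25'
  · exact (A.form_mul_eq_of_sub_mem_center d0 d2 d3).trans Q34'
  · exact (A.form_mul_eq_of_sub_mem_center d0 d2 d4).trans Q35'
  · exact (A.form_mul_eq_of_sub_mem_center d0 d3 d4).trans Q45'
  · exact (A.form_mul_eq_of_sub_mem_center d1 d2 d3).trans S34
  · exact (A.form_mul_eq_of_sub_mem_center d1 d2 d4).trans S35
  · exact (A.form_mul_eq_of_sub_mem_center d1 d3 d4).trans S45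
  · exact (A.form_mul_eq_of_sub_mem_center d2 d3 d4).trans T

end IsClass38

end TypeC
end SympAltAlg

namespace SympAltAlg

/-! ### Explicit isomorphisms between presentations -/

section Classification

variable {F : Type*} [Field F]

namespace NilpPres

theorem triple_P38 (r s : F) (u v w : Fin 5 ⊕ Fin 5 → F) :
    (P38 r s).triple u v w =
      r * minor (Sum.inl 1) (Sum.inr 3) (Sum.inr 4) u v w +
      s * minor (Sum.inl 0) (Sum.inr 2) (Sum.inr 4) u v w +
      minor (Sum.inl 0) (Sum.inr 1) (Sum.inr 3) u v w +
      minor (Sum.inr 0) (Sum.inr 1) (Sum.inr 4) u v w +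
      minor (Sum.inr 0) (Sum.inr 2) (Sum.inr 3) u v w := by
  simp [triple, P38, Fin.sum_univ_five]
  ring

theorem minor_eq {ι : Type*} (p q t : ι) (u v w : ι → F) :
    minor p q t u v w = u p * (v q * w t - v t * w q) - u q * (v p * w t - v t * w p) +
      u t * (v p * w q - v q * w p) := by
  simp [minor, Matrix.det_fin_three]
  ring

theorem stdForm_apply {n : ℕ} (u v : Fin n ⊕ Fin n → F) :
    stdForm F n u v = ∑ i, (u (Sum.inl i) * v (Sum.inr i) - u (Sum.inr i) * v (Sum.inl i)) := rfl

/-- A linear map that preserves the form and the triple form is an isomorphism. -/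
theorem describeSame_of_linearMap {n : ℕ} {P Q : NilpPres F n}
    (f : (Fin n ⊕ Fin n → F) →ₗ[F] (Fin n ⊕ Fin n → F))
    (hform : ∀ u v, stdForm F n (f u) (f v) = stdForm F n u v)
    (htriple : ∀ u v w, Q.triple (f u) (f v) (f w) = P.triple u v w) : P.DescribeSame Q := by
  have hinj : Function.Injective f := (injective_iff_map_eq_zero f).2 fun u hu =>
    P.algebra.form_nondegenerate u fun v => by
      change stdForm F n u v = 0
      rw [← hform, hu, map_zero, LinearMap.zero_apply]
  refine ⟨⟨LinearEquiv.ofInjectiveEndo f hinj, fun u v => ?_, hform⟩⟩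
  refine sub_eq_zero.1 (Q.algebra.form_nondegenerate _ fun w => ?_)
  obtain ⟨w, rfl⟩ := (LinearEquiv.ofInjectiveEndo f hinj).surjective w
  change stdForm F n (f (P.stdMul u v) - Q.stdMul (f u) (f v)) (f w) = 0
  rw [map_sub, LinearMap.sub_apply, hform, stdForm_stdMul, stdForm_stdMul, htriple, sub_self]

theorem describeSame_P38 {r s c d e D k : F} (hk : c * k = 1) (hD : (d ^ 2 - e ^ 2 * s) * D = 1) :
    (P38 (c ^ 3 * r) (s * D ^ 2)).DescribeSame (P38 r s) := by
  -- The $(x_1,y_1)$-block is built from $d+e\sqrt s$ and has determinant $(d^2-e^2s)D=1$. The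
  -- $(y_4,y_5)$-block has determinant $c^2$, which with $x_2\mapsto cx_2$ yields $c^3r$. The blocks
  -- on $x_3,x_4,x_5$ and on $y_2$ are then dictated by the form.
  let f : (Fin 5 ⊕ Fin 5 → F) →ₗ[F] (Fin 5 ⊕ Fin 5 → F) :=
    { toFun := fun u => Sum.elim
        ![d * D * u (Sum.inl 0) + e * u (Sum.inr 0), c * u (Sum.inl 1),
          c * (d ^ 2 - e ^ 2 * s) * u (Sum.inl 2),
          d * k * D * u (Sum.inl 3) + e * k * u (Sum.inl 4),
          e * s * k * D * u (Sum.inl 3) + d * k * u (Sum.inl 4)]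
        ![e * s * D * u (Sum.inl 0) + d * u (Sum.inr 0), k * u (Sum.inr 1),
          k * D * u (Sum.inr 2),
          c * d * u (Sum.inr 3) - c * e * s * D * u (Sum.inr 4),
          -(c * e) * u (Sum.inr 3) + c * d * D * u (Sum.inr 4)]
      map_add' := fun u v => by
        ext (i | i) <;> fin_cases i <;> simp <;> ring
      map_smul' := fun k u => by
        ext (i | i) <;> fin_cases i <;> simp <;> ring }
  have x₁ : ∀ u, f u (Sum.inl 0) = d * D * u (Sum.inl 0) + e * u (Sum.inr 0) := fun _ => rfl
  have x₂ : ∀ u, f u (Sum.inl 1) = c * u (Sum.inl 1) := fun _ => rfl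
  have y₁ : ∀ u, f u (Sum.inr 0) = e * s * D * u (Sum.inl 0) + d * u (Sum.inr 0) := fun _ => rfl
  have y₂ : ∀ u, f u (Sum.inr 1) = k * u (Sum.inr 1) := fun _ => rfl
  have y₃ : ∀ u, f u (Sum.inr 2) = k * D * u (Sum.inr 2) := fun _ => rfl
  have y₄ : ∀ u, f u (Sum.inr 3) = c * d * u (Sum.inr 3) - c * e * s * D * u (Sum.inr 4) :=
    fun _ => rfl
  have y₅ : ∀ u, f u (Sum.inr 4) = -(c * e) * u (Sum.inr 3) + c * d * D * u (Sum.inr 4) :=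
    fun _ => rfl
  refine describeSame_of_linearMap f (fun u v => ?_) fun u v w => ?_
  · let p : Fin 5 → F := fun i => u (Sum.inl i) * v (Sum.inr i) - u (Sum.inr i) * v (Sum.inl i)
    simp only [stdForm_apply, Fin.sum_univ_five]
    linear_combination (norm := (simp [f, p]; ring1))
      (p 0 + c * k * p 2 + c * k * p 3 + c * k * p 4) * hD + (p 1 + p 2 + p 3 + p 4) * hk
  · simp only [triple_P38]
    linear_combination (norm := skip)
      (r * c ^ 3 * minor (Sum.inl 1) (Sum.inr 3) (Sum.inr 4) u v w +
        c * k * (s * D ^ 2 * minor (Sum.inl 0) (Sum.inr 2) (Sum.inr 4) u v w +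
          minor (Sum.inl 0) (Sum.inr 1) (Sum.inr 3) u v w +
          minor (Sum.inr 0) (Sum.inr 1) (Sum.inr 4) u v w +
          minor (Sum.inr 0) (Sum.inr 2) (Sum.inr 3) u v w)) * hD +
        (s * D ^ 2 * minor (Sum.inl 0) (Sum.inr 2) (Sum.inr 4) u v w +
          minor (Sum.inl 0) (Sum.inr 1) (Sum.inr 3) u v w +
          minor (Sum.inr 0) (Sum.inr 1) (Sum.inr 4) u v w +
          minor (Sum.inr 0) (Sum.inr 2) (Sum.inr 3) u v w) * hk
    simp only [minor_eq, x₁, x₂, y₁, y₂, y₃, y₄, y₅]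
    clear x₁ x₂ y₁ y₂ y₃ y₄ y₅ hD hk
    clear_value f
    ring1

end NilpPres

end Classification
end SympAltAlg

namespace SympAltAlg

/-! ### Necessary conditions for isomorphism -/

section Invariants

variable {F : Type*} [Field F]

namespace NilpPres

theorem coord_eq_zero_of_central {r s : F} (hr : r ≠ 0) {z : Fin 5 ⊕ Fin 5 → F}
    (hz : ∀ v w, (P38 r s).triple z v w = 0) :
    z (Sum.inl 0) = 0 ∧ z (Sum.inl 1) = 0 ∧ ∀ i, z (Sum.inr i) = 0 := by
  -- Each pair of unit vectors chosen below isolates one coordinate of `z`, up to a nonzero factor;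
  -- only $x_2$ needs $r\ne0$.
  have h := fun i j => hz (Pi.single i 1) (Pi.single j 1)
  simp only [triple_P38, minor_eq] at h
  have a0 := h (Sum.inr 1) (Sum.inr 3)
  have a1 := h (Sum.inr 3) (Sum.inr 4)
  have b0 := h (Sum.inr 1) (Sum.inr 4)
  have b1 := h (Sum.inl 0) (Sum.inr 3)
  have b2 := h (Sum.inr 0) (Sum.inr 3)
  have b3 := h (Sum.inl 0) (Sum.inr 1)
  have b4 := h (Sum.inr 0) (Sum.inr 1)
  simp [hr] at a0 a1 b0 b1 b2 b3 b4
  exact ⟨a0, a1, fun i => by fin_cases i <;> assumption⟩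

theorem triple_P38_eq_zero {r s : F} {z : Fin 5 ⊕ Fin 5 → F} (h0 : z (Sum.inl 0) = 0)
    (h1 : z (Sum.inl 1) = 0) (hz : ∀ i, z (Sum.inr i) = 0) (v w : Fin 5 ⊕ Fin 5 → F) :
    (P38 r s).triple z v w = 0 := by
  simp [triple_P38, minor_eq, h0, h1, hz]

/-- Isomorphisms preserve `L^2`, the orthogonal complement of the centre. -/
theorem coord_eq_zero_of_mem_sq {r s r' s' : F} (hr' : r' ≠ 0)
    (f : (Fin 5 ⊕ Fin 5 → F) ≃ₗ[F] (Fin 5 ⊕ Fin 5 → F))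
    (hform : ∀ u v, stdForm F 5 (f u) (f v) = stdForm F 5 u v)
    (htriple : ∀ u v w, (P38 r s).triple (f u) (f v) (f w) = (P38 r' s').triple u v w)
    {u : Fin 5 ⊕ Fin 5 → F} (hu2 : u (Sum.inr 2) = 0) (hu3 : u (Sum.inr 3) = 0)
    (hu4 : u (Sum.inr 4) = 0) :
    f u (Sum.inr 2) = 0 ∧ f u (Sum.inr 3) = 0 ∧ f u (Sum.inr 4) = 0 := by
  have key : ∀ i : Fin 5, i ≠ 0 → i ≠ 1 → f u (Sum.inr i) = 0 := by
    intro i h0 h1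
    -- $x_{i+1}$ is central in the target, so its preimage is central in the source and pairs to
    -- zero with `u`.
    obtain ⟨z0, z1, z2⟩ := coord_eq_zero_of_central (s := s') hr'
      (z := f.symm (Pi.single (Sum.inl i) 1)) fun v w => by
        rw [← htriple, LinearEquiv.apply_symm_apply]
        refine triple_P38_eq_zero ?_ ?_ ?_ _ _
        · simp [h0.symm]
        · simp [h1.symm]
        · simp
    have h2 := hform (f.symm (Pi.single (Sum.inl i) 1)) u
    rw [LinearEquiv.apply_symm_apply, stdForm_apply, stdForm_apply, Fin.sum_univ_five
      (fun j => f.symm (Pi.single (Sum.inl i) 1) (Sum.inl j) * u (Sum.inr j) -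
        f.symm (Pi.single (Sum.inl i) 1) (Sum.inr j) * u (Sum.inl j))] at h2
    simpa [Pi.single_apply, z0, z1, z2, hu2, hu3, hu4] using h2
  exact ⟨key 2 (by decide) (by decide), key 3 (by decide) (by decide), key 4 (by decide) (by decide)⟩

/-- The letters are coordinates of an isomorphism: $x_1\mapsto Ax_1+By_1$, $y_1\mapsto Cx_1+Ey_1$,
$x_2\mapsto lx_2$, $y_2\mapsto my_2$, $y_3\mapsto ny_2+ky_3$, $y_4\mapsto py_4+qy_5$, $y_5\mapsto
p'y_4+q'y_5$, up to terms that do not matter. The equations `e1`–`e4` say that the $(y_4,y_5)$-block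
is $l$ times an inverse of the $(x_1,y_1)$-block. -/
theorem parameters_eq {r s r' s' l m n k A B C E p q p' q' : F} (h2 : (2 : F) ≠ 0) (hlm : l * m = 1)
    (hdet : A * E - B * C = 1) (e1 : m * (A * p + B * q) = 1) (e2 : m * (A * p' + B * q') = 0)
    (e3 : m * (C * p + E * q) = 0) (e4 : m * (C * p' + E * q') = 1)
    (e5 : n * (A * p + B * q) + k * (B * p + s * A * q) = 0)
    (e6 : n * (A * p' + B * q') + k * (B * p' + s * A * q') = s')
    (e7 : n * (C * p + E * q) + k * (E * p + s * C * q) = 1)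
    (e8 : n * (C * p' + E * q') + k * (E * p' + s * C * q') = 0)
    (e9 : r * l * (p * q' - q * p') = r') :
    r' = r * l ^ 3 ∧ s' * (E ^ 2 - C ^ 2 * s) ^ 2 = s := by
  have f1 : A * p + B * q = l := by linear_combination l * e1 - (A * p + B * q) * hlm
  have f2 : A * p' + B * q' = 0 := by linear_combination l * e2 - (A * p' + B * q') * hlm
  have f3 : C * p + E * q = 0 := by linear_combination l * e3 - (C * p + E * q) * hlm
  have f4 : C * p' + E * q' = l := by linear_combination l * e4 - (C * p' + E * q') * hlm
  obtain rfl : p = l * E := by linear_combination E * f1 - B * f3 - p * hdet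
  obtain rfl : q = -(l * C) := by linear_combination A * f3 - C * f1 - q * hdet
  obtain rfl : p' = -(l * B) := by linear_combination E * f2 - B * f4 - p' * hdet
  obtain rfl : q' = l * A := by linear_combination A * f4 - C * f2 - q' * hdet
  have hkl : k * l * (E ^ 2 - C ^ 2 * s) = 1 := by linear_combination e7 - n * f3
  -- The difference of `e5` and `e8` is $2kl(BE-sAC)=0$; characteristic not $2$ enters here.
  have g : B * E = s * A * C := by
    have h3 : k * l * 2 * (B * E - s * A * C) = 0 := by
      linear_combination e5 - e8 - n * f1 + n * f4
    have hkl0 : k * l ≠ 0 := left_ne_zero_of_mul (hkl ▸ one_ne_zero)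
    exact sub_eq_zero.1 ((mul_eq_zero.1 h3).resolve_left (mul_ne_zero hkl0 h2))
  refine ⟨by linear_combination -e9 + r * l ^ 3 * hdet, ?_⟩
  have gA : A * (E ^ 2 - C ^ 2 * s) = E := by linear_combination E * hdet + C * g
  have gB : B * (E ^ 2 - C ^ 2 * s) = s * C := by linear_combination s * C * hdet + E * g
  have hs' : s' = k * l * (s * A ^ 2 - B ^ 2) := by linear_combination -e6 + n * f2
  rw [hs']
  linear_combination k * l * s * (A * (E ^ 2 - C ^ 2 * s) + E) * gA -
    k * l * (B * (E ^ 2 - C ^ 2 * s) + s * C) * gB + s * hkl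

theorem parameters_of_describeSame (h2 : (2 : F) ≠ 0) {r s r' s' : F} (hr : r ≠ 0) (hr' : r' ≠ 0)
    (h : (P38 r' s').DescribeSame (P38 r s)) :
    ∃ l E C : F, l ≠ 0 ∧ r' = r * l ^ 3 ∧ s' * (E ^ 2 - C ^ 2 * s) ^ 2 = s ∧ (E, C) ≠ (0, 0) := by
  obtain ⟨g⟩ := h
  let f : (Fin 5 ⊕ Fin 5 → F) ≃ₗ[F] (Fin 5 ⊕ Fin 5 → F) := g.toLinearEquiv
  have hform : ∀ u v, stdForm F 5 (f u) (f v) = stdForm F 5 u v := g.map_form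
  have hmul : ∀ u v, f ((P38 r' s').stdMul u v) = (P38 r s).stdMul (f u) (f v) := g.map_mul
  have htriple : ∀ u v w, (P38 r s).triple (f u) (f v) (f w) = (P38 r' s').triple u v w :=
    fun u v w => by rw [← stdForm_stdMul, ← hmul, hform, stdForm_stdMul]
  clear_value f
  have hform' : ∀ u v, stdForm F 5 (f.symm u) (f.symm v) = stdForm F 5 u v := fun u v => by
    rw [← hform, f.apply_symm_apply, f.apply_symm_apply]
  have htriple' : ∀ u v w, (P38 r' s').triple (f.symm u) (f.symm v) (f.symm w) =
      (P38 r s).triple u v w := fun u v w => by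
    rw [← htriple, f.apply_symm_apply, f.apply_symm_apply, f.apply_symm_apply]
  obtain ⟨b, hb⟩ : ∃ b : Fin 5 ⊕ Fin 5 → Fin 5 ⊕ Fin 5 → F,
      ∀ i j, b i j = if j = i then 1 else 0 :=
    ⟨fun i => Pi.single i 1, fun i j => Pi.single_apply i 1 j⟩
  have hsq : ∀ i, i ≠ Sum.inr 2 → i ≠ Sum.inr 3 → i ≠ Sum.inr 4 → f (b i) (Sum.inr 2) = 0 ∧
      f (b i) (Sum.inr 3) = 0 ∧ f (b i) (Sum.inr 4) = 0 := fun i h2 h3 h4 =>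
    coord_eq_zero_of_mem_sq hr' f hform htriple (by simp [hb, h2.symm])
      (by simp [hb, h3.symm]) (by simp [hb, h4.symm])
  -- $x_2$ annihilates $L^2$ in the source, so its image annihilates $L^2$ in the target; `i1`–`i3`
  -- then remove its $x_1$-, $y_1$- and $y_2$-coordinates.
  have hx₂ : ∀ i, i ≠ Sum.inr 2 → i ≠ Sum.inr 3 → i ≠ Sum.inr 4 → ∀ w,
      (P38 r s).triple (f (b (Sum.inl 1))) (b i) w = 0 := by
    intro i h2 h3 h4 w
    obtain ⟨k2, k3, k4⟩ := coord_eq_zero_of_mem_sq hr f.symm hform' htriple' (u := b i)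
      (by simp [hb, h2.symm]) (by simp [hb, h3.symm])
      (by simp [hb, h4.symm])
    rw [← htriple', f.symm_apply_apply, triple_P38]
    simp only [minor_eq, k2, k3, k4]
    simp [hb]
  obtain ⟨xa2, xa3, xa4⟩ := hsq (Sum.inl 1) (by simp) (by simp) (by simp)
  obtain ⟨ya2, ya3, ya4⟩ := hsq (Sum.inr 1) (by simp) (by simp) (by simp)
  obtain ⟨xb2, xb3, xb4⟩ := hsq (Sum.inl 0) (by simp) (by simp) (by simp)
  obtain ⟨yb2, yb3, yb4⟩ := hsq (Sum.inr 0) (by simp) (by simp) (by simp)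
  have i1 := hx₂ (Sum.inr 1) (by simp) (by simp) (by simp) (b (Sum.inr 3))
  have i2 := hx₂ (Sum.inr 1) (by simp) (by simp) (by simp) (b (Sum.inr 4))
  have i3 := hx₂ (Sum.inl 0) (by simp) (by simp) (by simp) (b (Sum.inr 3))
  rw [triple_P38] at i1 i2 i3
  simp [minor_eq, hb] at i1 i2 i3
  have T := fun i j k => htriple (b i) (b j) (b k)
  have S := fun i j => hform (b i) (b j)
  -- $x_2y_3=0$ in the source; testing the image product against $y_4,y_5$ of the target shows, by
  -- $rl\ne0$, that the image of $y_3$ has no $y_4$- or $y_5$-coordinate.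
  have U := fun k => htriple (b (Sum.inl 1)) (b (Sum.inr 2)) (f.symm (b k))
  simp only [LinearEquiv.apply_symm_apply] at U
  simp only [triple_P38, minor_eq, stdForm_apply, Fin.sum_univ_five] at T S U
  have s1 := S (Sum.inl 1) (Sum.inr 1)
  have s2 := S (Sum.inl 1) (Sum.inl 0)
  have s3 := S (Sum.inl 1) (Sum.inr 0)
  have s4 := S (Sum.inl 0) (Sum.inr 0)
  have u3 := U (Sum.inr 3)
  have u4 := U (Sum.inr 4)
  have e1 := T (Sum.inl 0) (Sum.inr 1) (Sum.inr 3)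
  have e2 := T (Sum.inl 0) (Sum.inr 1) (Sum.inr 4)
  have e3 := T (Sum.inr 0) (Sum.inr 1) (Sum.inr 3)
  have e4 := T (Sum.inr 0) (Sum.inr 1) (Sum.inr 4)
  have e5 := T (Sum.inl 0) (Sum.inr 2) (Sum.inr 3)
  have e6 := T (Sum.inl 0) (Sum.inr 2) (Sum.inr 4)
  have e7 := T (Sum.inr 0) (Sum.inr 2) (Sum.inr 3)
  have e8 := T (Sum.inr 0) (Sum.inr 2) (Sum.inr 4)
  have e9 := T (Sum.inl 1) (Sum.inr 3) (Sum.inr 4)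
  clear T S U htriple' hform' htriple hform hmul
  simp [hb, i1, i2, i3, xa2, xa3, xa4, ya2, ya3, ya4, xb2, xb3, xb4, yb2, yb3, yb4]
    at s1 s2 s3 s4 u3 u4 e1 e2 e3 e4 e5 e6 e7 e8 e9
  have hl : f (b (Sum.inl 1)) (Sum.inl 1) ≠ 0 := left_ne_zero_of_mul (s1 ▸ one_ne_zero)
  simp [hl, hr] at s2 s3 u3 u4
  simp [s2, s3, u3, u4] at s4 e1 e2 e3 e4 e5 e6 e7 e8 e9
  obtain ⟨h3, h4⟩ := parameters_eq (r := r) (s := s) (r' := r') (s' := s')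
    (n := f (b (Sum.inr 2)) (Sum.inr 1)) (k := f (b (Sum.inr 2)) (Sum.inr 2))
    (p := f (b (Sum.inr 3)) (Sum.inr 3)) (q := f (b (Sum.inr 3)) (Sum.inr 4))
    (p' := f (b (Sum.inr 4)) (Sum.inr 3)) (q' := f (b (Sum.inr 4)) (Sum.inr 4)) h2 s1 s4
    (by linear_combination e1) (by linear_combination e2) (by linear_combination e3)
    (by linear_combination e4) (by linear_combination e5) (by linear_combination e6)
    (by linear_combination e7) (by linear_combination e8) (by linear_combination e9)
  refine ⟨_, _, _, hl, h3, h4, fun h0 => ?_⟩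
  obtain ⟨h5, h6⟩ := Prod.mk.inj h0
  rw [h5, h6] at s4
  simp at s4

end NilpPres

end Invariants
end SympAltAlg

/-! ### The proposition -/

theorem proposition4p13 {F : Type*} [Field F] (hchar : ringChar F ≠ 2) :
    (∀ {L : Type*} [AddCommGroup L] [Module F L] (A : SympAltAlg F L),
      Module.finrank F L = 10 →
      A.IsNilpotent →
      A.IsIsotropic A.center →
      Module.finrank F A.center = 3 →
      Module.finrank F (A.pow 3) = 6 →
      A.prod (A.pow 3) (A.pow 2) = A.pow 5 →
      A.IsTypeC →
      ∃ r s : F, r ≠ 0 ∧ ¬ IsSquare s ∧ A.HasPresentation (SympAltAlg.NilpPres.P38 r s)) ∧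
    (∀ r s r' s' : F, r ≠ 0 → ¬ IsSquare s → r' ≠ 0 → ¬ IsSquare s' →
      ((SympAltAlg.NilpPres.P38 r' s').DescribeSame (SympAltAlg.NilpPres.P38 r s) ↔
        (∃ c : F, c ≠ 0 ∧ r' / r = c ^ 3) ∧ s / s' ∈ SympAltAlg.G s)) := by
  have h2 : (2 : F) ≠ 0 := Ring.two_ne_zero hchar
  refine ⟨fun A hd hn hi hz h3 h5 hC => SympAltAlg.IsClass38.hasPresentation_of_isTypeC
    ⟨hd, hn, hi, hz, h3, h5⟩ h2 hC, fun r s r' s' hr hs hr' hs' => ⟨fun h => ?_, ?_⟩⟩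
  · obtain ⟨l, E, C, hl, e1, e2, hne⟩ :=
      SympAltAlg.NilpPres.parameters_of_describeSame h2 hr hr' h
    have hs0 : s' ≠ 0 := fun h0 => hs' (h0 ▸ IsSquare.zero)
    exact ⟨⟨l, hl, by rw [e1, mul_div_cancel_left₀ _ hr]⟩, E, C, hne, by
      rw [div_eq_iff hs0, mul_comm, e2]⟩
  · rintro ⟨⟨c, hc, e1⟩, x, y, hxy, e2⟩
    have hs0 : s' ≠ 0 := fun h0 => hs' (h0 ▸ IsSquare.zero)
    -- The norm form of $\mathbb F(\sqrt s)$ is anisotropic because $s$ is not a square.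
    have hD : x ^ 2 - y ^ 2 * s ≠ 0 := fun h0 => by
      have hy : y ≠ 0 := fun hy => by
        rw [hy] at h0 hxy
        exact hxy (by simpa using h0)
      exact hs ⟨x / y, by field_simp; linear_combination -h0⟩
    have h := SympAltAlg.NilpPres.describeSame_P38 (r := r) (mul_inv_cancel₀ hc)
      (mul_inv_cancel₀ hD)
    rw [(div_eq_iff hr).1 e1]
    convert h using 2
    rw [inv_pow, ← e2]
    have hs1 : s ≠ 0 := fun h0 => hs (h0 ▸ IsSquare.zero)
    field_simp
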